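/- Let $K$ be an algebraically closed field of arbitrary characteristic. A curve $C:\{f=0\}$ is given by a nonzero $f\in K[[x,y]]$ without constant term (up to units); it is reduced if $f$ has no multiple factors, and a branch if $f$ is irreducible. Its multiplicity is $m(C)=\operatorname{ord} f$; a branch is smooth if $m(C)=1$. The tangents of $C$ are the points $(a:b)\in\mathbb P^1(K)$ with $(\operatorname{in} f)(a,b)=0$, where $\operatorname{in} f$ is the initial form of $f$. For branches $C:\{f=0\}$ and $D:\{g=0\}$ put $$d(C,D)=\frac{\dim_K K[[x,y]]/(f,g)}{m(C)\,m(D)}\in[0,\infty],$$ and for reduced curves $C,D$ with irreducible components $C_i$, $D_j$ put $d(C,D)=\inf_{i,j}d(C_i,D_j)$. The contact exponent of a reduced curve $C$ is $d(C)=\sup_W d(C,W)$, where $W$ runs over all smooth branches; a smooth branch $W$ has maximal contact with $C$ if $d(C,W)=d(C)$. Let $C$ be a reduced curve with irreducible components $C_1,\dots,C_r$, $r\ge 1$. Then $d(C)$ is either $\infty$ or a rational number greater than or equal to $1$, and there exists a smooth branch $W$ that has maximal contact with $C$. Moreover, 1. $d(C)=\infty$ if and only if $C$ is a smooth branch; 2.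 $d(C)=1$ if and only if $C$ has at least two tangents; 3. $d(C)<\inf_{1\le i\le r} d(C_i)$ if and only if $d(C)$ is an integer. -/

import Mathlib

open scoped ENNReal

noncomputable section

namespace PlaneCurve

variable {K : Type*} [Field K]

/-- `IsCurve f`: the power series `f ∈ K[[x,y]]` is nonzero and has no constant term, so that
`{f = 0}` is an algebroid plane curve. Curves are represented by their equations; all notions
below are unchanged if `f` is multiplied by a unit. The variables `x`, `y` are indexed by
`0 1 : Fin 2`. -/
def IsCurve (f : MvPowerSeries (Fin 2) K) : Prop :=
  f ≠ 0 ∧ MvPowerSeries.constantCoeff f = 0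

/-- The curve `{f = 0}` is reduced: `f` has no multiple factors. -/
def IsReducedCurve (f : MvPowerSeries (Fin 2) K) : Prop :=
  IsCurve f ∧ Squarefree f

/-- The curve `{f = 0}` is a branch: `f` is irreducible. -/
def IsBranch (f : MvPowerSeries (Fin 2) K) : Prop :=
  IsCurve f ∧ Irreducible f

/-- The multiplicity of the curve `{f = 0}`: the order of `f`. -/
def mult (f : MvPowerSeries (Fin 2) K) : ℕ∞ := f.order

/-- A smooth branch: a branch of multiplicity one. -/
def IsSmoothBranch (f : MvPowerSeries (Fin 2) K) : Prop :=
  IsBranch f ∧ mult f = 1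

/-- The branch `{p = 0}` is an irreducible component of the curve `{f = 0}`. -/
def IsComponent (p f : MvPowerSeries (Fin 2) K) : Prop :=
  IsBranch p ∧ p ∣ f

/-- The intersection number `dim_K K[[x,y]]/(f,g)`, possibly infinite. -/
def intersectionNumber (f g : MvPowerSeries (Fin 2) K) : ℕ∞ :=
  Cardinal.toENat (Module.rank K (MvPowerSeries (Fin 2) K ⧸ Ideal.span {f, g}))

/-- The order of contact `(C,D)₀ / (m(C) m(D))` of two branches. -/
def branchContact (f g : MvPowerSeries (Fin 2) K) : ℝ≥0∞ :=
  (intersectionNumber f g : ℝ≥0∞) / ((mult f : ℝ≥0∞) * (mult g : ℝ≥0∞))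

/-- The order of contact `d(C,D)` of two reduced curves: the infimum of the orders of contact of
their irreducible components. -/
def contact (f g : MvPowerSeries (Fin 2) K) : ℝ≥0∞ :=
  ⨅ (p : MvPowerSeries (Fin 2) K) (_ : IsComponent p f)
    (q : MvPowerSeries (Fin 2) K) (_ : IsComponent q g), branchContact p q

/-- The contact exponent `d(C)`: the supremum of `d(C,W)` over all smooth branches `W`. -/
def contactExponent (f : MvPowerSeries (Fin 2) K) : ℝ≥0∞ :=
  ⨆ (w : MvPowerSeries (Fin 2) K) (_ : IsSmoothBranch w), contact f w

/-- The smooth branch `{w = 0}` has maximal contact with the curve `{f = 0}`. -/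
def HasMaximalContact (w f : MvPowerSeries (Fin 2) K) : Prop :=
  IsSmoothBranch w ∧ contact f w = contactExponent f

/-- The initial form of a nonzero power series: its homogeneous part of degree `ord f`. -/
def initialForm (f : MvPowerSeries (Fin 2) K) : MvPolynomial (Fin 2) K :=
  ∑ ij ∈ Finset.HasAntidiagonal.antidiagonal f.order.toNat,
    MvPolynomial.monomial (Finsupp.single 0 ij.1 + Finsupp.single 1 ij.2)
      (MvPowerSeries.coeff (Finsupp.single 0 ij.1 + Finsupp.single 1 ij.2) f)

/-- The tangent cone: the points `(a : b)` of the projective line with `(in f)(a, b) = 0`. This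
does not depend on the representative, see `mk_mem_tangentCone`. -/
def tangentCone (f : MvPowerSeries (Fin 2) K) : Set (Projectivization K (Fin 2 → K)) :=
  {P | MvPolynomial.eval P.rep (initialForm f) = 0}

theorem eval_smul_initialForm (f : MvPowerSeries (Fin 2) K) (c : K) (v : Fin 2 → K) :
    MvPolynomial.eval (c • v) (initialForm f) =
      c ^ f.order.toNat * MvPolynomial.eval v (initialForm f) := by
  simp only [initialForm, map_sum, Finset.mul_sum]
  refine Finset.sum_congr rfl fun ij hij => ?_
  rw [← Finset.HasAntidiagonal.mem_antidiagonal.mp hij]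
  simp only [MvPolynomial.eval_monomial, Finsupp.prod_fintype, pow_zero, implies_true,
    Fin.prod_univ_two, Finsupp.add_apply, Pi.smul_apply, smul_eq_mul]
  simp
  ring

theorem mk_mem_tangentCone (f : MvPowerSeries (Fin 2) K) (v : Fin 2 → K) (hv : v ≠ 0) :
    Projectivization.mk K v hv ∈ tangentCone f ↔
      MvPolynomial.eval v (initialForm f) = 0 := by
  obtain ⟨a, ha⟩ := Projectivization.exists_smul_eq_mk_rep K v hv
  change MvPolynomial.eval (Projectivization.mk K v hv).rep (initialForm f) = 0 ↔ _
  rw [← ha, Units.smul_def, eval_smul_initialForm]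
  simp

end PlaneCurve

end

noncomputable section

namespace PlaneCurve

variable {K : Type*} [Field K]

/-! Fix a direction `(1, c)` that is not a tangent of the curve. In coordinates adapted to it, each
component has a distinguished polynomial `P` over `K⟦t⟧`, irreducible over the fraction field, whose
degree `n` is the multiplicity. A smooth branch either has tangent `(1, c)`, and then meets the
component with the least possible intersection number `n`, or is a graph `x = φ(t)`, `y = t + c
φ(t)`, and then the intersection number is `ord P(φ)`. Contact is thus governed by the function `φ ↦
ord P(φ)`.

Two facts about it carry the proof, both derived from the Hensel-type statement
`coeff_constantCoeff_eq_zero_of_irreducible`. By `min_order_eval_eq`, among `ord P(φ)`, `ord P(ψ)`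
and `n · ord(ψ - φ)` the minimum occurs twice. By `exists_order_eval_lt`, over an algebraically
closed field a value `ord P(φ) = n N` can be raised by adding a multiple of `t ^ N` to `φ`. So a
non-integral contact with a branch is already maximal, while an integral one never is; comparing the
curve with its components gives the third equivalence.

Contacts with the components have a common denominator, so a bounded supremum is attained. If the
contacts are unbounded, the graphs form a Cauchy sequence whose limit is every component, and
reducedness leaves a single smooth branch. For tangents, contact with a smooth branch exceeds 1
exactly when the branch is tangent to every component. -/

/-! ### Irreducible polynomials over `K⟦X⟧` and the orders of their values. -/

instance isAdicComplete_powerSeries :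
    IsAdicComplete (IsLocalRing.maximalIdeal (PowerSeries K)) (PowerSeries K) where
  haus' f hf := by
    ext n
    have h := hf (n + 1)
    rw [SModEq.zero, smul_eq_mul, Ideal.mul_top, PowerSeries.maximalIdeal_eq_span_X,
      Ideal.span_singleton_pow, Ideal.mem_span_singleton, PowerSeries.X_pow_dvd_iff] at h
    simpa using h n (Nat.lt_succ_self n)
  prec' f hf := by
    have key : ∀ {m n : ℕ}, m ≤ n → ∀ i < m, PowerSeries.coeff i (f m) = PowerSeries.coeff i (f n) := by
      intro m n hmn i hi
      have h := hf hmn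
      rw [SModEq.sub_mem, smul_eq_mul, Ideal.mul_top, PowerSeries.maximalIdeal_eq_span_X,
        Ideal.span_singleton_pow, Ideal.mem_span_singleton, PowerSeries.X_pow_dvd_iff] at h
      simpa [sub_eq_zero] using h i hi
    refine ⟨PowerSeries.mk fun k => PowerSeries.coeff k (f (k + 1)), fun n => ?_⟩
    rw [SModEq.sub_mem, smul_eq_mul, Ideal.mul_top, PowerSeries.maximalIdeal_eq_span_X,
        Ideal.span_singleton_pow, Ideal.mem_span_singleton, PowerSeries.X_pow_dvd_iff]
    intro i hi
    rw [map_sub, PowerSeries.coeff_mk, key (Nat.succ_le_of_lt hi) i (Nat.lt_succ_self i), sub_self]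

theorem residue_eq_zero_iff (a : PowerSeries K) :
    IsLocalRing.residue (PowerSeries K) a = 0 ↔ PowerSeries.constantCoeff a = 0 := by
  rw [IsLocalRing.residue_eq_zero_iff, PowerSeries.maximalIdeal_eq_span_X,
    Ideal.mem_span_singleton, PowerSeries.X_dvd_iff]

theorem mem_maximalIdeal_iff (a : PowerSeries K) :
    a ∈ IsLocalRing.maximalIdeal (PowerSeries K) ↔ PowerSeries.constantCoeff a = 0 := by
  rw [← residue_eq_zero_iff, IsLocalRing.residue_eq_zero_iff]

/-- Irreducibility over the fraction field of `K⟦X⟧`. -/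
def IrreducibleOverFrac (Q : Polynomial (PowerSeries K)) : Prop :=
  Irreducible (Q.map (algebraMap (PowerSeries K) (FractionRing (PowerSeries K))))

/-- Weierstrass preparation gives `Q = F * h` with `F` distinguished and `h` a unit power series.
Uniqueness of division by `F` makes `h` the polynomial `Q /ₘ F`, and irreducibility makes one factor
constant. It is not `F`, since `Q` would then be a unit power series, against `h0`. So `Q` is a
constant times a distinguished polynomial. -/
theorem coeff_constantCoeff_eq_zero_of_irreducible (Q : Polynomial (PowerSeries K))
    (hQ : IrreducibleOverFrac Q) (h0 : PowerSeries.constantCoeff (Q.coeff 0) = 0)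
    (hne : Q.map PowerSeries.constantCoeff ≠ 0) :
    ∀ j < Q.natDegree, PowerSeries.constantCoeff (Q.coeff j) = 0 := by
  have hg : (Q : PowerSeries (PowerSeries K)).map (IsLocalRing.residue (PowerSeries K)) ≠ 0 := by
    contrapose! hne
    ext j
    have h := congrArg (PowerSeries.coeff j) hne
    rw [PowerSeries.coeff_map, Polynomial.coeff_coe, map_zero, residue_eq_zero_iff] at h
    rwa [Polynomial.coeff_map, Polynomial.coeff_zero]
  obtain ⟨F, h, H⟩ := PowerSeries.exists_isWeierstrassFactorization hg
  have hF := H.isDistinguishedAt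
  have hmon : F.Monic := hF.monic
  have HF : (F : PowerSeries (PowerSeries K)).IsWeierstrassFactorization F 1 :=
    ⟨hF, isUnit_one, by simp⟩
  have hdeg : F.degree = ((F : PowerSeries (PowerSeries K)).map
      (Ideal.Quotient.mk (IsLocalRing.maximalIdeal (PowerSeries K)))).order.toNat := by
    rw [Polynomial.degree_eq_natDegree hmon.ne_zero, HF.natDegree_eq_toNat_order_map]
    rfl
  have h1 : (Q : PowerSeries (PowerSeries K)).IsWeierstrassDivision F h 0 :=
    ⟨by rw [← hdeg, Polynomial.degree_zero]; exact bot_lt_iff_ne_bot.2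
          (by simpa using hmon.ne_zero), by simpa using H.eq_mul⟩
  have h2 : (Q : PowerSeries (PowerSeries K)).IsWeierstrassDivision F
      ((Q /ₘ F : Polynomial (PowerSeries K)) : PowerSeries (PowerSeries K)) (Q %ₘ F) :=
    ⟨by rw [← hdeg]; exact Polynomial.degree_modByMonic_lt Q hmon, by
      rw [← Polynomial.coe_mul, ← Polynomial.coe_add, add_comm, Polynomial.modByMonic_add_div]⟩
  obtain ⟨hT, hR⟩ := h1.elim HF.map_ne_zero h2
  have hQF : Q = F * (Q /ₘ F) := by
    conv_lhs => rw [← Polynomial.modByMonic_add_div Q F, ← hR, zero_add]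
  have hinj := IsFractionRing.injective (PowerSeries K) (FractionRing (PowerSeries K))
  rw [IrreducibleOverFrac, hQF, Polynomial.map_mul] at hQ
  rcases hQ.isUnit_or_isUnit rfl with hu | hu
  · exfalso
    have hF1 : F.natDegree = 0 := by
      rw [← hmon.natDegree_map (algebraMap (PowerSeries K) (FractionRing (PowerSeries K)))]
      exact Polynomial.natDegree_eq_zero_of_isUnit hu
    have hF1' : F = 1 := hmon.natDegree_eq_zero.1 hF1
    have hQh : (Q : PowerSeries (PowerSeries K)) = h := by simpa [hF1'] using H.eq_mul
    have hu := H.isUnit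
    rw [← hQh, PowerSeries.isUnit_iff_constantCoeff, PowerSeries.isUnit_iff_constantCoeff] at hu
    simp [h0] at hu
  · have hT0 : (Q /ₘ F).natDegree = 0 := by
      rw [← Polynomial.natDegree_map_eq_of_injective hinj]
      exact Polynomial.natDegree_eq_zero_of_isUnit hu
    obtain ⟨t, ht⟩ := Polynomial.natDegree_eq_zero.1 hT0
    intro j hj
    rw [hQF, ← ht, mul_comm] at hj ⊢
    rw [Polynomial.coeff_C_mul, map_mul]
    have := hF.mem (n := j) (hj.trans_le (Polynomial.natDegree_C_mul_le t F))
    rw [mem_maximalIdeal_iff] at this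
    rw [this, mul_zero]

/-- Dividing out the content makes the reduction modulo `X` usable. -/
theorem exists_eq_X_pow_mul (Q : Polynomial (PowerSeries K)) (hQ : Q ≠ 0) :
    ∃ (k : ℕ) (Q' : Polynomial (PowerSeries K)), Q = Polynomial.C (PowerSeries.X ^ k) * Q' ∧
      Q'.map PowerSeries.constantCoeff ≠ 0 := by
  have hfin : FiniteMultiplicity (Polynomial.C (PowerSeries.X : PowerSeries K)) Q := by
    refine FiniteMultiplicity.of_not_isUnit ?_ hQ
    rw [Polynomial.isUnit_C]
    exact PowerSeries.X_prime.not_isUnit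
  obtain ⟨Q', h1, h2⟩ := hfin.exists_eq_pow_mul_and_not_dvd
  refine ⟨_, Q', by rw [h1, Polynomial.C_pow], fun h => h2 ?_⟩
  rw [Polynomial.C_dvd_iff_dvd_coeff]
  intro i
  rw [PowerSeries.X_dvd_iff, ← Polynomial.coeff_map, h, Polynomial.coeff_zero]

theorem IrreducibleOverFrac.of_C_mul {a : PowerSeries K} {Q : Polynomial (PowerSeries K)}
    (h : IrreducibleOverFrac (Polynomial.C a * Q)) : IrreducibleOverFrac Q := by
  unfold IrreducibleOverFrac at *
  have h0 := h.ne_zero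
  rw [Polynomial.map_mul, Polynomial.map_C] at h h0
  refine (irreducible_isUnit_mul ?_).1 h
  rw [Polynomial.isUnit_C, isUnit_iff_ne_zero]
  intro ha
  simp [ha] at h0

theorem IrreducibleOverFrac.comp_linear {Q : Polynomial (PowerSeries K)}
    (hQ : IrreducibleOverFrac Q) {a : PowerSeries K} (ha : a ≠ 0) (b : PowerSeries K) :
    IrreducibleOverFrac (Q.comp (Polynomial.C a * Polynomial.X + Polynomial.C b)) := by
  have ha' : algebraMap (PowerSeries K) (FractionRing (PowerSeries K)) a ≠ 0 := by
    simpa using ha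
  let _ := invertibleOfNonzero ha'
  unfold IrreducibleOverFrac at *
  rw [← MulEquiv.irreducible_iff (Polynomial.algEquivCMulXAddC
    (algebraMap (PowerSeries K) (FractionRing (PowerSeries K)) a) (algebraMap _ _ b))] at hQ
  rw [Polynomial.map_comp]
  rw [Polynomial.algEquivCMulXAddC_apply, ← Polynomial.comp_eq_aeval] at hQ
  simpa using hQ

theorem IrreducibleOverFrac.natDegree_pos {Q : Polynomial (PowerSeries K)}
    (hQ : IrreducibleOverFrac Q) : 0 < Q.natDegree := by
  have := Irreducible.natDegree_pos hQ
  exact this.trans_le Polynomial.natDegree_map_le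

/-- Isosceles property for the values at `0`, `1` and `∞` of an irreducible polynomial. -/
theorem min_order_eval_zero_eval_one (Q : Polynomial (PowerSeries K))
    (hQ : IrreducibleOverFrac Q) :
    min (Q.eval 0).order (Q.eval 1).order = min (Q.eval 0).order Q.leadingCoeff.order ∧
    min (Q.eval 0).order (Q.eval 1).order = min (Q.eval 1).order Q.leadingCoeff.order := by
  have hQ0 : Q ≠ 0 := by
    rintro rfl
    exact hQ.ne_zero (by simp)
  obtain ⟨k, Q', rfl, hne⟩ := exists_eq_X_pow_mul Q hQ0
  have hQ' := hQ.of_C_mul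
  have hpos := hQ'.natDegree_pos
  have e0 : Q'.coeff 0 = Q'.eval 0 := Polynomial.coeff_zero_eq_eval_zero Q'
  -- Such a `T` reduces to its leading coefficient times a power of the variable, so its reduced
  -- values are explicit.
  have hsplit : ∀ T : Polynomial (PowerSeries K), T.map PowerSeries.constantCoeff ≠ 0 →
      (∀ j < T.natDegree, PowerSeries.constantCoeff (T.coeff j) = 0) →
      PowerSeries.constantCoeff T.leadingCoeff ≠ 0 ∧ ∀ a : PowerSeries K,
        PowerSeries.constantCoeff (T.eval a) = PowerSeries.constantCoeff T.leadingCoeff *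
          (PowerSeries.constantCoeff a) ^ T.natDegree := by
    intro T hT hj
    have hlead : PowerSeries.constantCoeff T.leadingCoeff ≠ 0 := by
      intro h
      apply hT
      ext j
      rw [Polynomial.coeff_map, Polynomial.coeff_zero]
      rcases lt_trichotomy j T.natDegree with h' | rfl | h'
      · exact hj j h'
      · exact h
      · rw [Polynomial.coeff_eq_zero_of_natDegree_lt h', map_zero]
    refine ⟨hlead, fun a => ?_⟩
    rw [Polynomial.eval_eq_sum_range, map_sum, Finset.sum_range_succ, Finset.sum_eq_zero, zero_add,
      map_mul, map_pow]
    · rfl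
    · intro j hj'
      rw [map_mul, hj j (Finset.mem_range.1 hj'), zero_mul]
  have hA : PowerSeries.constantCoeff (Q'.eval 0) = 0 →
      PowerSeries.constantCoeff Q'.leadingCoeff ≠ 0 ∧ PowerSeries.constantCoeff (Q'.eval 1) ≠ 0 := by
    intro h
    obtain ⟨h1, h2⟩ := hsplit Q' hne (coeff_constantCoeff_eq_zero_of_irreducible Q' hQ'
      (by rwa [e0]) hne)
    exact ⟨h1, by rw [h2]; simpa using h1⟩
  have hB : PowerSeries.constantCoeff (Q'.eval 1) = 0 →
      PowerSeries.constantCoeff Q'.leadingCoeff ≠ 0 ∧ PowerSeries.constantCoeff (Q'.eval 0) ≠ 0 := by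
    intro h
    -- Translation by 1 turns a vanishing value at 1 into a vanishing constant term; the old value
    -- at 0 is then the value at -1.
    have hT := hQ'.comp_linear one_ne_zero 1
    set T := Q'.comp (Polynomial.C 1 * Polynomial.X + Polynomial.C 1) with hTdef
    have hnat : T.natDegree = Q'.natDegree := by
      rw [hTdef, Polynomial.natDegree_comp, Polynomial.natDegree_linear one_ne_zero, mul_one]
    have hl : T.leadingCoeff = Q'.leadingCoeff := by
      rw [hTdef, Polynomial.leadingCoeff_comp (by rw [Polynomial.natDegree_linear one_ne_zero]; simp),
        Polynomial.leadingCoeff_linear one_ne_zero, one_pow, mul_one]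
    have hev : ∀ a, T.eval a = Q'.eval (a + 1) := fun a => by simp [hTdef]
    have hTne : T.map PowerSeries.constantCoeff ≠ 0 := by
      intro h0
      apply hne
      rw [hTdef, Polynomial.map_comp] at h0
      have := congrArg (fun q => q.comp (Polynomial.X - 1)) h0
      simpa [Polynomial.comp_assoc] using this
    obtain ⟨h1, h2⟩ := hsplit T hTne (coeff_constantCoeff_eq_zero_of_irreducible T hT
      (by rw [Polynomial.coeff_zero_eq_eval_zero, hev, zero_add, h]) hTne)
    rw [hl] at h1 h2
    refine ⟨h1, ?_⟩
    have := h2 (-1)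
    rw [hev, neg_add_cancel] at this
    rw [this]
    exact mul_ne_zero h1 (by simp)
  have ho : ∀ a : PowerSeries K, a.order = 0 ↔ PowerSeries.constantCoeff a ≠ 0 := fun a =>
    ⟨fun h h' => PowerSeries.order_ne_zero_iff_constCoeff_eq_zero.2 h' h, fun h => by
      by_contra h'
      exact h (PowerSeries.order_ne_zero_iff_constCoeff_eq_zero.1 h')⟩
  have hC : Polynomial.leadingCoeff (Polynomial.C (PowerSeries.X ^ k : PowerSeries K)) =
    PowerSeries.X ^ k := Polynomial.leadingCoeff_C _
  simp only [Polynomial.eval_mul, Polynomial.eval_C, Polynomial.leadingCoeff_mul, hC,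
    PowerSeries.order_mul, min_add_add_left]
  have hm : ∀ {x y : ℕ∞}, (x = 0 ∨ y = 0) → min x y = 0 := by
    rintro x y (rfl | rfl) <;> simp
  -- Without content, at most one of the values at 0, 1 and ∞ is a non-unit, so every pairwise
  -- minimum is 0.
  have h1 : min (Q'.eval 0).order (Q'.eval 1).order = 0 := by
    apply hm
    simp only [ho]
    by_contra! h
    exact (hA h.1).2 h.2
  have h2 : min (Q'.eval 0).order Q'.leadingCoeff.order = 0 := by
    apply hm
    simp only [ho]
    by_contra! h
    exact (hA h.1).1 h.2
  have h3 : min (Q'.eval 1).order Q'.leadingCoeff.order = 0 := by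
    apply hm
    simp only [ho]
    by_contra! h
    exact (hB h.1).1 h.2
  rw [h1, h2, h3]
  simp

theorem leadingCoeff_comp_linear {P : Polynomial (PowerSeries K)} (hP : P.Monic)
    {a : PowerSeries K} (ha : a ≠ 0) (b : PowerSeries K) :
    (P.comp (Polynomial.C a * Polynomial.X + Polynomial.C b)).leadingCoeff = a ^ P.natDegree := by
  rw [Polynomial.leadingCoeff_comp (by rw [Polynomial.natDegree_linear ha]; exact one_ne_zero),
    Polynomial.leadingCoeff_linear ha, hP.leadingCoeff, one_mul]

/-- The strong triangle inequality for an irreducible monic polynomial `P` and two smooth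
branches `y = φ`, `y = ψ`, as an isosceles property. -/
theorem min_order_eval_eq {P : Polynomial (PowerSeries K)} (hP : P.Monic)
    (hirr : IrreducibleOverFrac P) (φ ψ : PowerSeries K) :
    min (P.eval φ).order (P.eval ψ).order =
      min (P.eval φ).order (P.natDegree • (ψ - φ).order) := by
  rcases eq_or_ne (ψ - φ) 0 with h | h
  · rw [sub_eq_zero] at h
    have : P.natDegree • (⊤ : ℕ∞) = ⊤ := by
      rw [nsmul_eq_mul, ENat.mul_top]
      exact_mod_cast hirr.natDegree_pos.ne'
    simp [h, this]
  -- The affine substitution carries 0 and 1 to `φ` and `ψ`, and its leading coefficient is `(ψ - φ)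
  -- ^ n`.
  · have := (min_order_eval_zero_eval_one _ (hirr.comp_linear h φ)).1
    rw [leadingCoeff_comp_linear hP h, PowerSeries.order_pow] at this
    simpa [Polynomial.eval_comp] using this

/-- A smooth branch `y = φ` whose order of contact with an irreducible `P` is an integer can be
improved. -/
theorem exists_order_eval_lt [IsAlgClosed K] {P : Polynomial (PowerSeries K)} (hP : P.Monic)
    (hirr : IrreducibleOverFrac P) (φ : PowerSeries K) (N : ℕ)
    (hN : (P.eval φ).order = (P.natDegree * N : ℕ)) :
    ∃ c : K, (P.eval φ).order <
      (P.eval (φ + PowerSeries.C c * PowerSeries.X ^ N)).order := by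
  have hX : (PowerSeries.X ^ N : PowerSeries K) ≠ 0 := pow_ne_zero _ PowerSeries.X_ne_zero
  have hQ := hirr.comp_linear hX φ
  have hlead := leadingCoeff_comp_linear hP hX φ
  have hev : ∀ a, (P.comp (Polynomial.C (PowerSeries.X ^ N) * Polynomial.X +
      Polynomial.C φ)).eval a = P.eval (φ + a * PowerSeries.X ^ N) := by
    intro a
    simp [Polynomial.eval_comp, add_comm, mul_comm]
  have hQ0 : P.comp (Polynomial.C (PowerSeries.X ^ N) * Polynomial.X + Polynomial.C φ) ≠ 0 := by
    intro h
    apply hQ.ne_zero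
    rw [h, Polynomial.map_zero]
  obtain ⟨k, Q', hQQ, hne⟩ := exists_eq_X_pow_mul _ hQ0
  rw [hQQ] at hQ hlead hev
  have hQ' := hQ.of_C_mul
  have h0 := hev 0
  rw [zero_mul, add_zero, Polynomial.eval_mul, Polynomial.eval_C] at h0
  rw [Polynomial.leadingCoeff_mul, Polynomial.leadingCoeff_C, ← pow_mul] at hlead
  have hlead' := congrArg PowerSeries.order hlead
  rw [PowerSeries.order_mul, PowerSeries.order_X_pow, PowerSeries.order_X_pow, mul_comm N,
    ← hN, ← h0, PowerSeries.order_mul, PowerSeries.order_X_pow] at hlead'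
  have hlo : Q'.leadingCoeff.order = (Q'.eval 0).order :=
    ENat.add_right_injective_of_ne_top (ENat.natCast_ne_top k) hlead'
  -- Since the order is exactly `n N`, constant and leading coefficients of `Q'` have equal order.
  -- Were both non-units, all coefficients would reduce to 0. So the reduction has full degree and a
  -- root `c`, at which the order grows.
  have hunit : PowerSeries.constantCoeff Q'.leadingCoeff ≠ 0 := by
    intro h
    have hc : PowerSeries.constantCoeff (Q'.coeff 0) = 0 := by
      rw [Polynomial.coeff_zero_eq_eval_zero, ← PowerSeries.order_ne_zero_iff_constCoeff_eq_zero,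
        ← hlo, PowerSeries.order_ne_zero_iff_constCoeff_eq_zero, h]
    apply hne
    ext j
    rw [Polynomial.coeff_map, Polynomial.coeff_zero]
    rcases lt_trichotomy j Q'.natDegree with h' | rfl | h'
    · exact coeff_constantCoeff_eq_zero_of_irreducible Q' hQ' hc hne j h'
    · exact h
    · rw [Polynomial.coeff_eq_zero_of_natDegree_lt h', map_zero]
  have hunit0 : (Q'.eval 0).order = 0 := by
    rw [← hlo]
    by_contra h
    exact hunit (PowerSeries.order_ne_zero_iff_constCoeff_eq_zero.1 h)
  obtain ⟨c, hc⟩ := IsAlgClosed.exists_root (Q'.map PowerSeries.constantCoeff) (by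
    rw [Polynomial.degree_map_eq_of_leadingCoeff_ne_zero _ hunit]
    exact (Polynomial.natDegree_pos_iff_degree_pos.1 hQ'.natDegree_pos).ne')
  refine ⟨c, ?_⟩
  rw [← hev, ← h0, Polynomial.eval_mul, Polynomial.eval_C, PowerSeries.order_mul,
    PowerSeries.order_mul, hunit0, PowerSeries.order_X_pow]
  refine (ENat.add_lt_add_iff_left (ENat.natCast_ne_top k)).2 ?_
  rw [pos_iff_ne_zero, PowerSeries.order_ne_zero_iff_constCoeff_eq_zero]
  rw [Polynomial.IsRoot, Polynomial.eval_map, ← PowerSeries.constantCoeff_C c,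
    Polynomial.eval₂_hom] at hc
  exact hc

/-! ### Intersection numbers as orders along a parametrization. -/

theorem exists_unit_eq_X_pow_order_mul (g : PowerSeries K) (hg : g ≠ 0) :
    ∃ u : PowerSeries K, IsUnit u ∧ g = PowerSeries.X ^ g.order.toNat * u := by
  refine ⟨g.divXPowOrder, ?_, (PowerSeries.X_pow_order_mul_divXPowOrder).symm⟩
  rw [PowerSeries.isUnit_iff_constantCoeff, isUnit_iff_ne_zero, ne_eq,
    PowerSeries.constantCoeff_divXPowOrder_eq_zero_iff]
  exact hg

/-- The first `n` coefficients of a power series. -/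
def coeffsBelow (K : Type*) [Field K] (n : ℕ) : PowerSeries K →ₗ[K] (Fin n → K) :=
  LinearMap.pi fun i => PowerSeries.coeff (i : ℕ)

theorem coeffsBelow_surjective (n : ℕ) : Function.Surjective (coeffsBelow K n) := by
  intro v
  refine ⟨PowerSeries.mk fun i => if h : i < n then v ⟨i, h⟩ else 0, ?_⟩
  ext i
  simp [coeffsBelow]

theorem coeffsBelow_eq_zero_iff (n : ℕ) (g : PowerSeries K) :
    coeffsBelow K n g = 0 ↔ PowerSeries.X ^ n ∣ g := by
  rw [PowerSeries.X_pow_dvd_iff, funext_iff]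
  exact ⟨fun h m hm => h ⟨m, hm⟩, fun h i => h i i.2⟩

/-- For `g` of finite order `n` the first `n` coefficients are coordinates on the quotient. For `g =
0` every `n` is a lower bound for the rank, matching the order `⊤`. -/
theorem toENat_rank_quotient (g : PowerSeries K) :
    Cardinal.toENat (Module.rank K (PowerSeries K ⧸ Ideal.span {g})) = g.order := by
  have hle : ∀ n : ℕ, PowerSeries.X ^ n ∣ g →
      (n : Cardinal) ≤ Module.rank K (PowerSeries K ⧸ Ideal.span {g}) := by
    intro n hn
    have hk : (Ideal.span {g}).restrictScalars K ≤ LinearMap.ker (coeffsBelow K n) := by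
      intro r hr
      rw [LinearMap.mem_ker, coeffsBelow_eq_zero_iff]
      exact hn.trans (Ideal.mem_span_singleton.1 hr)
    have hs : Function.Surjective
        (((Ideal.span {g}).restrictScalars K).liftQ (coeffsBelow K n) hk) := by
      intro v
      obtain ⟨r, hr⟩ := coeffsBelow_surjective n v
      exact ⟨Submodule.Quotient.mk r, by simpa using hr⟩
    have := LinearMap.rank_le_of_surjective _ hs
    rw [rank_fin_fun] at this
    exact this
  rcases eq_or_ne g 0 with rfl | hg
  · rw [PowerSeries.order_zero, Cardinal.toENat_eq_top]
    exact Cardinal.aleph0_le.2 fun n => hle n (dvd_zero _)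
  · obtain ⟨u, hu, h⟩ := exists_unit_eq_X_pow_order_mul g hg
    set n := g.order.toNat with hn
    have hk : LinearMap.ker (coeffsBelow K n) ≤ (Ideal.span {g}).restrictScalars K := by
      intro r hr
      rw [LinearMap.mem_ker, coeffsBelow_eq_zero_iff] at hr
      rw [Submodule.restrictScalars_mem, Ideal.mem_span_singleton, h]
      exact (hu.mul_right_dvd).2 hr
    have h1 : Module.rank K (PowerSeries K ⧸ Ideal.span {g}) ≤ n := by
      have h2 : Module.rank K (PowerSeries K ⧸ Ideal.span {g}) ≤
          Module.rank K (PowerSeries K ⧸ LinearMap.ker (coeffsBelow K n)) := by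
        refine LinearMap.rank_le_of_surjective ((LinearMap.ker (coeffsBelow K n)).liftQ
          (Ideal.Quotient.mkₐ K (Ideal.span {g})).toLinearMap ?_) ?_
        · intro r hr
          rw [LinearMap.mem_ker]
          exact Ideal.Quotient.eq_zero_iff_mem.2 (hk hr)
        · intro v
          obtain ⟨r, rfl⟩ := Ideal.Quotient.mk_surjective v
          exact ⟨Submodule.Quotient.mk r, rfl⟩
      rw [((coeffsBelow K n).quotKerEquivOfSurjective (coeffsBelow_surjective n)).rank_eq,
        rank_fin_fun] at h2
      exact h2
    have h2 := hle n PowerSeries.X_pow_order_dvd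
    rw [le_antisymm h1 h2, Cardinal.toENat_nat, hn, PowerSeries.coe_toNat_order hg]

/-- A parametrization of the smooth branch `{w = 0}`. -/
structure IsParametrization (ψ : MvPowerSeries (Fin 2) K →ₐ[K] PowerSeries K)
    (w : MvPowerSeries (Fin 2) K) : Prop where
  surjective : Function.Surjective ψ
  eq_zero_iff : ∀ r, ψ r = 0 ↔ w ∣ r

/-- The ideal `(p, w)` is the kernel of `ψ` followed by reduction modulo `ψ p`, which reduces the
count to one variable. -/
theorem IsParametrization.intersectionNumber_eq
    {ψ : MvPowerSeries (Fin 2) K →ₐ[K] PowerSeries K} {w : MvPowerSeries (Fin 2) K}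
    (h : IsParametrization ψ w) (p : MvPowerSeries (Fin 2) K) :
    intersectionNumber p w = (ψ p).order := by
  rw [← toENat_rank_quotient, intersectionNumber]
  let Φ := (Ideal.Quotient.mkₐ K (Ideal.span {ψ p})).comp ψ
  have hΦ : Function.Surjective Φ :=
    (Ideal.Quotient.mkₐ_surjective K _).comp h.surjective
  have hker : RingHom.ker Φ = Ideal.span {p, w} := by
    ext r
    rw [RingHom.mem_ker, Ideal.mem_span_pair]
    change Ideal.Quotient.mk _ (ψ r) = 0 ↔ _
    rw [Ideal.Quotient.eq_zero_iff_mem, Ideal.mem_span_singleton']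
    constructor
    · rintro ⟨a, ha⟩
      obtain ⟨b, rfl⟩ := h.surjective a
      have : ψ (r - b * p) = 0 := by rw [map_sub, map_mul, ha, sub_self]
      obtain ⟨c, hc⟩ := (h.eq_zero_iff _).1 this
      exact ⟨b, c, by rw [mul_comm c, ← hc]; ring⟩
    · rintro ⟨a, b, rfl⟩
      refine ⟨ψ a, ?_⟩
      rw [map_add, map_mul, map_mul, (h.eq_zero_iff w).2 dvd_rfl, mul_zero, add_zero]
  rw [← hker]
  congr 1
  exact (Ideal.quotientKerAlgEquivOfSurjective hΦ).toLinearEquiv.rank_eq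

/-! ### Evaluation of power series at an element of the ideal. -/

section EvalAt

variable {A : Type*} [CommRing A] {I : Ideal A}

theorem isDistinguishedAt_X_sub_C {a : A} (ha : a ∈ I) :
    (Polynomial.X - Polynomial.C a).IsDistinguishedAt I where
  monic := Polynomial.monic_X_sub_C a
  mem := by
    nontriviality A
    intro n hn
    rw [Polynomial.natDegree_X_sub_C, Nat.lt_one_iff] at hn
    subst hn
    simpa using ha

variable [IsAdicComplete I A]

/-- Evaluation of power series over a complete ring at a topologically nilpotent element. -/
def evalAt {a : A} (ha : a ∈ I) : PowerSeries A →+* A :=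
  -- Weierstrass division identifies `A⟦Y⟧/(Y - a)` with `A[Y]/(Y - a)`, hence with `A`; the kernel
  -- is explicit by construction.
  ((Polynomial.quotientSpanXSubCAlgEquiv a).toRingEquiv.toRingHom.comp
    (isDistinguishedAt_X_sub_C ha).algEquivQuotient.symm.toRingEquiv.toRingHom).comp
    (Ideal.Quotient.mk (Ideal.span
      {((Polynomial.X - Polynomial.C a : Polynomial A) : PowerSeries A)}))

theorem evalAt_coe {a : A} (ha : a ∈ I) (P : Polynomial A) : evalAt ha P = P.eval a := by
  have h : (isDistinguishedAt_X_sub_C ha).algEquivQuotient (Ideal.Quotient.mk _ P) =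
      Ideal.Quotient.mk _ (P : PowerSeries A) := by
    rfl
  change Polynomial.quotientSpanXSubCAlgEquiv a
    ((isDistinguishedAt_X_sub_C ha).algEquivQuotient.symm (Ideal.Quotient.mk _ _)) = _
  rw [← h, AlgEquiv.symm_apply_apply, Polynomial.quotientSpanXSubCAlgEquiv_mk]

theorem evalAt_eq_zero_iff {a : A} (ha : a ∈ I) (F : PowerSeries A) : evalAt ha F = 0 ↔
    ((Polynomial.X - Polynomial.C a : Polynomial A) : PowerSeries A) ∣ F := by
  change Polynomial.quotientSpanXSubCAlgEquiv a
    ((isDistinguishedAt_X_sub_C ha).algEquivQuotient.symm (Ideal.Quotient.mk _ _)) = _ ↔ _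
  rw [EmbeddingLike.map_eq_zero_iff, EmbeddingLike.map_eq_zero_iff,
    Ideal.Quotient.eq_zero_iff_mem, Ideal.mem_span_singleton]

theorem evalAt_surjective {a : A} (ha : a ∈ I) : Function.Surjective (evalAt ha) := by
  intro b
  exact ⟨(Polynomial.C b : Polynomial A), by rw [evalAt_coe, Polynomial.eval_C]⟩

theorem evalAt_C {a : A} (ha : a ∈ I) (b : A) : evalAt ha (PowerSeries.C b) = b := by
  rw [← Polynomial.coe_C, evalAt_coe, Polynomial.eval_C]

theorem evalAt_X {a : A} (ha : a ∈ I) : evalAt ha PowerSeries.X = a := by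
  rw [← Polynomial.coe_X, evalAt_coe, Polynomial.eval_X]

attribute [irreducible] evalAt

end EvalAt

/-! ### Orders and initial forms under local parametrizations. -/

theorem isUnit_iff_constantCoeff_ne_zero (f : MvPowerSeries (Fin 2) K) :
    IsUnit f ↔ MvPowerSeries.constantCoeff f ≠ 0 := by
  rw [MvPowerSeries.isUnit_iff_constantCoeff, isUnit_iff_ne_zero]

/-- The terms free of `x` are split off. This is the induction step showing that a local
homomorphism does not lower orders; no continuity has to be assumed. -/
theorem exists_eq_X_mul_add_X_mul (f : MvPowerSeries (Fin 2) K) (n : ℕ)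
    (hf : ((n + 1 : ℕ) : ℕ∞) ≤ f.order) :
    ∃ g h : MvPowerSeries (Fin 2) K, f = MvPowerSeries.X 0 * g + MvPowerSeries.X 1 * h ∧
      (n : ℕ∞) ≤ g.order ∧ (n : ℕ∞) ≤ h.order := by
  let f₀ : MvPowerSeries (Fin 2) K := fun d => if d 0 = 0 then MvPowerSeries.coeff d f else 0
  have hf₀ : ∀ d, MvPowerSeries.coeff d f₀ = if d 0 = 0 then MvPowerSeries.coeff d f else 0 :=
    fun d => rfl
  have hz : ∀ d : Fin 2 →₀ ℕ, (d.degree : ℕ∞) < (n + 1 : ℕ) → MvPowerSeries.coeff d f = 0 :=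
    fun d hd => MvPowerSeries.coeff_of_lt_order (hd.trans_le hf)
  have h0 : MvPowerSeries.X 0 ∣ f - f₀ := by
    rw [MvPowerSeries.X_dvd_iff]
    intro d hd
    rw [map_sub, hf₀, if_pos hd, sub_self]
  have h1 : MvPowerSeries.X 1 ∣ f₀ := by
    rw [MvPowerSeries.X_dvd_iff]
    intro d hd
    rw [hf₀]
    split_ifs with h
    · have : d = 0 := by
        ext i
        fin_cases i
        · exact h
        · exact hd
      subst this
      exact hz 0 (by simp)
    · rfl
  have o0 : ((n + 1 : ℕ) : ℕ∞) ≤ f₀.order := by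
    refine MvPowerSeries.le_order fun d hd => ?_
    rw [hf₀, hz d hd, ite_self]
  have o1 : ((n + 1 : ℕ) : ℕ∞) ≤ (f - f₀).order := by
    refine MvPowerSeries.le_order fun d hd => ?_
    rw [map_sub, hf₀, hz d hd, ite_self, sub_zero]
  obtain ⟨g, hg⟩ := h0
  obtain ⟨h, hh⟩ := h1
  have oX : ∀ i : Fin 2, (MvPowerSeries.X i : MvPowerSeries (Fin 2) K).order = 1 := by
    intro i
    rw [MvPowerSeries.X, MvPowerSeries.order_monomial_of_ne_zero one_ne_zero]
    simp
  rw [hg, MvPowerSeries.order_mul, oX, Nat.cast_add, add_comm, Nat.cast_one] at o1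
  rw [hh, MvPowerSeries.order_mul, oX, Nat.cast_add, add_comm, Nat.cast_one] at o0
  refine ⟨g, h, by rw [← hg, ← hh]; ring, ?_, ?_⟩
  · exact (ENat.add_le_add_iff_left (by simp)).1 o1
  · exact (ENat.add_le_add_iff_left (by simp)).1 o0

/-- An algebra homomorphism to `K⟦X⟧` which is given by series without constant term. -/
def IsLocalParam (ψ : MvPowerSeries (Fin 2) K →ₐ[K] PowerSeries K) : Prop :=
  ∀ i, PowerSeries.constantCoeff (ψ (MvPowerSeries.X i)) = 0

theorem IsLocalParam.le_order {ψ : MvPowerSeries (Fin 2) K →ₐ[K] PowerSeries K}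
    (hψ : IsLocalParam ψ) (n : ℕ) (f : MvPowerSeries (Fin 2) K) (hf : (n : ℕ∞) ≤ f.order) :
    (n : ℕ∞) ≤ (ψ f).order := by
  induction n generalizing f with
  | zero => simp
  | succ n ih =>
    obtain ⟨g, h, rfl, hg, hh⟩ := exists_eq_X_mul_add_X_mul f n hf
    have h1 : ∀ i, 1 ≤ (ψ (MvPowerSeries.X i)).order := fun i => by
      rw [PowerSeries.one_le_order_iff_constCoeff_eq_zero]
      exact hψ i
    rw [map_add, map_mul, map_mul]
    refine le_trans (le_min ?_ ?_) (PowerSeries.min_order_le_order_add _ _)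
    · rw [PowerSeries.order_mul, Nat.cast_add, add_comm]
      exact add_le_add (h1 0) (ih g hg)
    · rw [PowerSeries.order_mul, Nat.cast_add, add_comm]
      exact add_le_add (h1 1) (ih h hh)

theorem IsLocalParam.order_le {ψ : MvPowerSeries (Fin 2) K →ₐ[K] PowerSeries K}
    (hψ : IsLocalParam ψ) (f : MvPowerSeries (Fin 2) K) : f.order ≤ (ψ f).order := by
  refine ENat.forall_natCast_le_iff_le.1 fun n hn => hψ.le_order n f hn

theorem finsupp_fin_two (d : Fin 2 →₀ ℕ) :
    Finsupp.single 0 (d 0) + Finsupp.single 1 (d 1) = d := by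
  ext i
  fin_cases i <;> simp

theorem coeff_initialForm (f : MvPowerSeries (Fin 2) K) (d : Fin 2 →₀ ℕ) :
    (initialForm f).coeff d = if d 0 + d 1 = f.order.toNat then MvPowerSeries.coeff d f else 0 := by
  rw [initialForm, MvPolynomial.coeff_sum]
  simp only [MvPolynomial.coeff_monomial]
  split_ifs with h
  · rw [Finset.sum_eq_single (d 0, d 1)]
    · rw [if_pos (finsupp_fin_two d), finsupp_fin_two d]
    · intro b _ hb
      rw [if_neg]
      rintro rfl
      apply hb
      simp
    · intro h'
      exact absurd (Finset.HasAntidiagonal.mem_antidiagonal.2 h) h'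
  · refine Finset.sum_eq_zero fun b hb => ?_
    rw [if_neg]
    rintro rfl
    apply h
    rw [← Finset.HasAntidiagonal.mem_antidiagonal.1 hb]
    simp

/-- The vector of linear coefficients of a parametrization. -/
def tangentVector (ψ : MvPowerSeries (Fin 2) K →ₐ[K] PowerSeries K) : Fin 2 → K :=
  fun i => PowerSeries.coeff 1 (ψ (MvPowerSeries.X i))

/-- Only the initial form contributes in this degree. Being homogeneous, it yields a factor `X ^ m`
when each coordinate is written as `X * s i`, and the remaining factor has its value at the tangent
vector as constant term. -/
theorem IsLocalParam.coeff_order {ψ : MvPowerSeries (Fin 2) K →ₐ[K] PowerSeries K}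
    (hψ : IsLocalParam ψ) {f : MvPowerSeries (Fin 2) K} (hf : f ≠ 0) :
    PowerSeries.coeff f.order.toNat (ψ f) =
      MvPolynomial.eval (tangentVector ψ) (initialForm f) := by
  set m := f.order.toNat with hm
  have hm' : (m : ℕ∞) = f.order := MvPowerSeries.ne_zero_iff_order_finite.1 hf
  have hrest : ((m + 1 : ℕ) : ℕ∞) ≤
      (f - (initialForm f : MvPowerSeries (Fin 2) K)).order := by
    refine MvPowerSeries.le_order fun d hd => ?_
    rw [map_sub, MvPolynomial.coeff_coe, coeff_initialForm, ← hm]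
    have hd' : d.degree = d 0 + d 1 := by
      rw [Finsupp.degree_eq_sum, Fin.sum_univ_two]
    split_ifs with h
    · exact sub_self _
    · rw [sub_zero]
      apply MvPowerSeries.coeff_of_lt_order
      rw [← hm']
      rw [hd'] at hd ⊢
      have := Nat.cast_lt.1 hd
      exact_mod_cast lt_of_le_of_ne (Nat.lt_succ_iff.1 this) h
  have h1 := hψ.le_order _ _ hrest
  have h2 : PowerSeries.coeff m (ψ (f - (initialForm f : MvPowerSeries (Fin 2) K))) = 0 :=
    PowerSeries.coeff_of_lt_order _ (lt_of_lt_of_le (by exact_mod_cast Nat.lt_succ_self m) h1)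
  rw [map_sub, map_sub, sub_eq_zero] at h2
  rw [h2]
  have hs : ∀ i, ∃ s : PowerSeries K, ψ (MvPowerSeries.X i) = PowerSeries.X * s := fun i =>
    PowerSeries.X_dvd_iff.2 (hψ i)
  choose s hs using hs
  have hv : ∀ i, tangentVector ψ i = PowerSeries.constantCoeff (s i) := by
    intro i
    rw [tangentVector, hs, ← PowerSeries.coeff_zero_eq_constantCoeff_apply]
    exact PowerSeries.coeff_succ_X_mul 0 (s i)
  have hcoe : ∀ P : MvPolynomial (Fin 2) K, ψ (P : MvPowerSeries (Fin 2) K) =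
      MvPolynomial.aeval (fun i => ψ (MvPowerSeries.X i)) P := by
    intro P
    induction P using MvPolynomial.induction_on with
    | C a =>
      rw [MvPolynomial.coe_C, MvPolynomial.aeval_C]
      exact ψ.commutes a
    | add p q hp hq => rw [MvPolynomial.coe_add, map_add, map_add, hp, hq]
    | mul_X p i hp => rw [MvPolynomial.coe_mul, map_mul, map_mul, hp, MvPolynomial.coe_X,
        MvPolynomial.aeval_X]
  rw [hcoe, initialForm, ← hm, map_sum, map_sum, map_sum]
  refine Finset.sum_congr rfl fun b hb => ?_
  rw [← Finset.HasAntidiagonal.mem_antidiagonal.1 hb, MvPolynomial.aeval_monomial,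
    MvPolynomial.eval_monomial, Finsupp.prod_fintype _ _ (fun i => pow_zero _),
    Finsupp.prod_fintype _ _ (fun i => pow_zero _), Fin.prod_univ_two, Fin.prod_univ_two]
  simp only [Finsupp.add_apply, Finsupp.single_eq_same, hs, hv]
  simp only [ne_eq, one_ne_zero, zero_ne_one, not_false_eq_true, Finsupp.single_eq_of_ne, add_zero,
    zero_add]
  have : (PowerSeries.X * s 0) ^ b.1 * (PowerSeries.X * s 1) ^ b.2 =
    PowerSeries.X ^ (b.1 + b.2) * (s 0 ^ b.1 * s 1 ^ b.2) := by ring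
  rw [this, ← Algebra.smul_def, PowerSeries.coeff_smul, smul_eq_mul]
  congr 1
  have h3 := PowerSeries.coeff_X_pow_mul (s 0 ^ b.1 * s 1 ^ b.2) (b.1 + b.2) 0
  rw [zero_add] at h3
  rw [h3]
  simp

/-! ### Sheared coordinates and smooth branches as graphs. -/

theorem hasSubst_shear (c : K) : MvPowerSeries.HasSubst
    (![MvPowerSeries.X 0, MvPowerSeries.X 1 + MvPowerSeries.C c * MvPowerSeries.X 0] :
      Fin 2 → MvPowerSeries (Fin 2) K) := by
  apply MvPowerSeries.hasSubst_of_constantCoeff_zero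
  intro i
  fin_cases i <;> simp

/-- The substitution `y ↦ y + c x`. -/
def shearHom (c : K) : MvPowerSeries (Fin 2) K →ₐ[K] MvPowerSeries (Fin 2) K :=
  MvPowerSeries.substAlgHom (hasSubst_shear c)

theorem shearHom_X_zero (c : K) : shearHom c (MvPowerSeries.X 0) = MvPowerSeries.X 0 := by
  rw [shearHom, MvPowerSeries.substAlgHom_X]; rfl

theorem shearHom_X_one (c : K) : shearHom c (MvPowerSeries.X 1) =
    MvPowerSeries.X 1 + MvPowerSeries.C c * MvPowerSeries.X 0 := by
  rw [shearHom, MvPowerSeries.substAlgHom_X]; rfl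

theorem shearHom_shearHom_neg (c : K) (f : MvPowerSeries (Fin 2) K) :
    shearHom c (shearHom (-c) f) = f := by
  rw [shearHom, shearHom, MvPowerSeries.substAlgHom_apply, MvPowerSeries.substAlgHom_apply,
    MvPowerSeries.subst_comp_subst_apply (hasSubst_shear (-c)) (hasSubst_shear c)]
  have hC : ∀ r : K, MvPowerSeries.subst (![MvPowerSeries.X 0, MvPowerSeries.X 1 +
      MvPowerSeries.C c * MvPowerSeries.X 0] : Fin 2 → MvPowerSeries (Fin 2) K)
      (MvPowerSeries.C r) = MvPowerSeries.C r := fun r => by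
    rw [← MvPowerSeries.substAlgHom_apply (hasSubst_shear c)]
    exact (MvPowerSeries.substAlgHom (hasSubst_shear c)).commutes r
  have : (fun s : Fin 2 => MvPowerSeries.subst (![MvPowerSeries.X 0, MvPowerSeries.X 1 +
      MvPowerSeries.C c * MvPowerSeries.X 0] : Fin 2 → MvPowerSeries (Fin 2) K)
      ((![MvPowerSeries.X 0, MvPowerSeries.X 1 + MvPowerSeries.C (-c) * MvPowerSeries.X 0] :
      Fin 2 → MvPowerSeries (Fin 2) K) s)) = MvPowerSeries.X := by
    funext i
    fin_cases i
    · simp [MvPowerSeries.subst_X (hasSubst_shear c)]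
    · simp [MvPowerSeries.subst_X (hasSubst_shear c), MvPowerSeries.subst_add (hasSubst_shear c),
        MvPowerSeries.subst_mul (hasSubst_shear c), hC, -map_neg]
      simp
  rw [this, MvPowerSeries.subst_self, id]

/-- The automorphism `y ↦ y + c x` of `K⟦x,y⟧`. -/
def shear (c : K) : MvPowerSeries (Fin 2) K ≃ₐ[K] MvPowerSeries (Fin 2) K :=
  AlgEquiv.ofAlgHom (shearHom c) (shearHom (-c)) (AlgHom.ext (shearHom_shearHom_neg c))
    (AlgHom.ext fun f => by simpa using shearHom_shearHom_neg (-c) f)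

/-- Power series in one variable. -/
def univariateEquiv (K : Type*) [Field K] : MvPowerSeries (Fin 1) K ≃ₐ[K] PowerSeries K :=
  MvPowerSeries.renameEquiv K (Equiv.equivPUnit (Fin 1))

theorem univariateEquiv_X : univariateEquiv K (MvPowerSeries.X 0) = PowerSeries.X := by
  simp [univariateEquiv, PowerSeries.X]

/-- The identification of `K⟦x,y⟧` with `K⟦y⟧⟦x⟧`. -/
def nestedEquiv (K : Type*) [Field K] :
    MvPowerSeries (Fin 2) K ≃ₐ[K] PowerSeries (PowerSeries K) :=
  (MvPowerSeries.finSuccEquiv K 1).trans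
    (AlgEquiv.ofAlgHom (PowerSeries.mapAlgHom (univariateEquiv K : _ →ₐ[K] PowerSeries K))
      (PowerSeries.mapAlgHom ((univariateEquiv K).symm : PowerSeries K →ₐ[K] _))
      (AlgHom.ext fun f => by ext1 n; simp [PowerSeries.mapAlgHom_apply])
      (AlgHom.ext fun f => by ext1 n; simp [PowerSeries.mapAlgHom_apply]))

theorem nestedEquiv_X_zero : nestedEquiv K (MvPowerSeries.X 0) = PowerSeries.X := by
  simp [nestedEquiv, PowerSeries.mapAlgHom_apply]

theorem nestedEquiv_X_one :
    nestedEquiv K (MvPowerSeries.X 1) = PowerSeries.C PowerSeries.X := by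
  have := MvPowerSeries.finSuccEquiv_X_succ (R := K) (n := 1) 0
  rw [Fin.succ_zero_eq_one] at this
  simp [nestedEquiv, PowerSeries.mapAlgHom_apply, this, univariateEquiv_X]

/-- The coordinates `x = Y`, `y = X + c Y` with values in `K⟦X⟧⟦Y⟧`. -/
def coords (c : K) : MvPowerSeries (Fin 2) K ≃ₐ[K] PowerSeries (PowerSeries K) :=
  (shear c).trans (nestedEquiv K)

theorem coords_X_zero (c : K) : coords c (MvPowerSeries.X 0) = PowerSeries.X := by
  change nestedEquiv K (shearHom c _) = _
  rw [shearHom_X_zero, nestedEquiv_X_zero]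

theorem algebraMap_nested (c : K) : algebraMap K (PowerSeries (PowerSeries K)) c =
    PowerSeries.C (PowerSeries.C c) := by
  rw [PowerSeries.algebraMap_apply, PowerSeries.algebraMap_apply]
  rfl

theorem coords_X_one (c : K) : coords c (MvPowerSeries.X 1) =
    PowerSeries.C PowerSeries.X + PowerSeries.C (PowerSeries.C c) * PowerSeries.X := by
  change nestedEquiv K (shearHom c _) = _
  rw [shearHom_X_one, map_add, map_mul, nestedEquiv_X_zero, nestedEquiv_X_one]
  congr 2
  exact ((nestedEquiv K).commutes c).trans (algebraMap_nested c)

theorem coords_C (c a : K) : coords c (algebraMap K _ a) = PowerSeries.C (PowerSeries.C a) :=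
  ((coords c).commutes a).trans (algebraMap_nested a)

/-- Restriction to the line `X = 0` in the coordinates `coords c`. -/
def axisHom (c : K) : MvPowerSeries (Fin 2) K →ₐ[K] PowerSeries K where
  toRingHom := (PowerSeries.map PowerSeries.constantCoeff).comp (coords c : _ →+* _)
  commutes' a := by
    change PowerSeries.map PowerSeries.constantCoeff (coords c (algebraMap K _ a)) = _
    rw [coords_C, PowerSeries.map_C, PowerSeries.constantCoeff_C]
    rfl

theorem axisHom_apply (c : K) (f : MvPowerSeries (Fin 2) K) :
    axisHom c f = PowerSeries.map PowerSeries.constantCoeff (coords c f) := rfl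

theorem axisHom_X_zero (c : K) : axisHom c (MvPowerSeries.X 0) = PowerSeries.X := by
  rw [axisHom_apply, coords_X_zero, PowerSeries.map_X]

theorem axisHom_X_one (c : K) :
    axisHom c (MvPowerSeries.X 1) = PowerSeries.C c * PowerSeries.X := by
  rw [axisHom_apply, coords_X_one]
  simp

theorem isLocalParam_axisHom (c : K) : IsLocalParam (axisHom c) := by
  intro i
  fin_cases i
  · simp [axisHom_X_zero]
  · simp [axisHom_X_one]

theorem tangentVector_axisHom (c : K) : tangentVector (axisHom c) = ![1, c] := by
  funext i
  fin_cases i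
  · simp [tangentVector, axisHom_X_zero]
  · simp [tangentVector, axisHom_X_one]

theorem mem_of_constantCoeff_eq_zero {φ : PowerSeries K} (hφ : PowerSeries.constantCoeff φ = 0) :
    φ ∈ IsLocalRing.maximalIdeal (PowerSeries K) :=
  (mem_maximalIdeal_iff φ).2 hφ

/-- The parametrization `x = φ(t)`, `y = t + c φ(t)`. -/
def graphHom (c : K) {φ : PowerSeries K} (hφ : PowerSeries.constantCoeff φ = 0) :
    MvPowerSeries (Fin 2) K →ₐ[K] PowerSeries K where
  toRingHom := (evalAt (mem_of_constantCoeff_eq_zero hφ)).comp (coords c : _ →+* _)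
  commutes' a := by
    change evalAt _ (coords c (algebraMap K _ a)) = _
    rw [coords_C, evalAt_C]
    rfl

theorem graphHom_apply (c : K) {φ : PowerSeries K} (hφ : PowerSeries.constantCoeff φ = 0)
    (f : MvPowerSeries (Fin 2) K) :
    graphHom c hφ f = evalAt (mem_of_constantCoeff_eq_zero hφ) (coords c f) := rfl

theorem graphHom_X_zero (c : K) {φ : PowerSeries K} (hφ : PowerSeries.constantCoeff φ = 0) :
    graphHom c hφ (MvPowerSeries.X 0) = φ := by
  rw [graphHom_apply, coords_X_zero, evalAt_X]

theorem graphHom_X_one (c : K) {φ : PowerSeries K} (hφ : PowerSeries.constantCoeff φ = 0) :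
    graphHom c hφ (MvPowerSeries.X 1) = PowerSeries.X + PowerSeries.C c * φ := by
  rw [graphHom_apply, coords_X_one, map_add, map_mul, evalAt_C, evalAt_C, evalAt_X]

theorem isLocalParam_graphHom (c : K) {φ : PowerSeries K}
    (hφ : PowerSeries.constantCoeff φ = 0) : IsLocalParam (graphHom c hφ) := by
  intro i
  fin_cases i
  · simpa [graphHom_X_zero] using hφ
  · simp [graphHom_X_one, hφ]

theorem tangentVector_graphHom (c : K) {φ : PowerSeries K}
    (hφ : PowerSeries.constantCoeff φ = 0) : tangentVector (graphHom c hφ) =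
      ![PowerSeries.coeff 1 φ, 1 + c * PowerSeries.coeff 1 φ] := by
  funext i
  fin_cases i
  · simp [tangentVector, graphHom_X_zero]
  · simp [tangentVector, graphHom_X_one]

theorem tangentVector_graphHom_ne_zero (c : K) {φ : PowerSeries K}
    (hφ : PowerSeries.constantCoeff φ = 0) : tangentVector (graphHom c hφ) ≠ 0 := by
  intro h
  rw [tangentVector_graphHom] at h
  have h0 := congrFun h 0
  have h1 := congrFun h 1
  simp at h0 h1
  simp [h0] at h1

/-- The equation of the smooth branch parametrized by `graphHom`. -/
def graphEquation (c : K) (φ : PowerSeries K) : MvPowerSeries (Fin 2) K :=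
  (coords c).symm ((Polynomial.X - Polynomial.C φ : Polynomial (PowerSeries K)) :
    PowerSeries (PowerSeries K))

theorem isParametrization_graphHom (c : K) {φ : PowerSeries K}
    (hφ : PowerSeries.constantCoeff φ = 0) :
    IsParametrization (graphHom c hφ) (graphEquation c φ) where
  surjective := (evalAt_surjective (mem_of_constantCoeff_eq_zero hφ)).comp (coords c).surjective
  eq_zero_iff r := by
    rw [graphHom_apply, evalAt_eq_zero_iff, graphEquation,
      ← map_dvd_iff (coords c) (a := (coords c).symm _), AlgEquiv.apply_symm_apply]

theorem IsParametrization.of_associated {ψ : MvPowerSeries (Fin 2) K →ₐ[K] PowerSeries K}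
    {w w' : MvPowerSeries (Fin 2) K} (h : IsParametrization ψ w) (ha : Associated w w') :
    IsParametrization ψ w' :=
  ⟨h.surjective, fun r => by rw [h.eq_zero_iff, ha.dvd_iff_dvd_left]⟩

theorem IsParametrization.prime {ψ : MvPowerSeries (Fin 2) K →ₐ[K] PowerSeries K}
    {w : MvPowerSeries (Fin 2) K} (h : IsParametrization ψ w) (hw : w ≠ 0) : Prime w := by
  refine ⟨hw, fun hu => ?_, fun a b hab => ?_⟩
  · have := (h.eq_zero_iff 1).2 hu.dvd
    rw [map_one] at this
    exact one_ne_zero this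
  · rw [← h.eq_zero_iff, map_mul, mul_eq_zero, h.eq_zero_iff, h.eq_zero_iff] at hab
    exact hab

theorem isBranch_of_irreducible {p : MvPowerSeries (Fin 2) K} (hp : Irreducible p) :
    IsBranch p := by
  refine ⟨⟨hp.ne_zero, ?_⟩, hp⟩
  by_contra h
  exact hp.not_isUnit ((isUnit_iff_constantCoeff_ne_zero p).2 h)

theorem IsCurve.one_le_order {f : MvPowerSeries (Fin 2) K} (hf : IsCurve f) : 1 ≤ f.order :=
  MvPowerSeries.one_le_order_iff_constCoeff_eq_zero.2 hf.2

/-- The parametrization lands in a domain, so the equation is prime. Its restriction to the axis has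
order 1, and restriction does not lower the order. -/
theorem isSmoothBranch_graphEquation (c : K) {φ : PowerSeries K}
    (hφ : PowerSeries.constantCoeff φ = 0) : IsSmoothBranch (graphEquation c φ) := by
  have h0 : graphEquation c φ ≠ 0 := by
    rw [graphEquation, ne_eq, EmbeddingLike.map_eq_zero_iff, Polynomial.coe_eq_zero_iff]
    exact Polynomial.X_sub_C_ne_zero φ
  have hb := isBranch_of_irreducible ((isParametrization_graphHom c hφ).prime h0).irreducible
  refine ⟨hb, le_antisymm ?_ hb.1.one_le_order⟩
  refine ((isLocalParam_axisHom c).order_le _).trans ?_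
  rw [axisHom_apply, graphEquation, AlgEquiv.apply_symm_apply]
  simp [hφ]

/-! ### Weierstrass polynomials of branches, and invariance under units. -/

/-- The Weierstrass polynomial of a branch which is transversal to the axis. -/
theorem IsBranch.exists_polynomial {p : MvPowerSeries (Fin 2) K} (hp : IsBranch p) {c : K}
    (hc : MvPolynomial.eval ![1, c] (initialForm p) ≠ 0) :
    ∃ P : Polynomial (PowerSeries K), P.IsDistinguishedAt (IsLocalRing.maximalIdeal _) ∧
      IrreducibleOverFrac P ∧ (P.natDegree : ℕ∞) = mult p ∧
      Associated (coords c p) (P : PowerSeries (PowerSeries K)) := by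
  have hord := MvPowerSeries.ne_zero_iff_order_finite.1 hp.1.1
  set m := p.order.toNat with hm
  -- Transversality means that the order does not grow on the axis, so the Weierstrass degree is the
  -- multiplicity.
  have hax : (axisHom c p).order = m := by
    rw [PowerSeries.order_eq_nat]
    constructor
    · rw [(isLocalParam_axisHom c).coeff_order hp.1.1, tangentVector_axisHom]
      exact hc
    · intro i hi
      apply PowerSeries.coeff_of_lt_order
      refine lt_of_lt_of_le ?_ ((isLocalParam_axisHom c).order_le p)
      rw [← hord]
      exact_mod_cast hi
  have hres : ((coords c p).map (IsLocalRing.residue (PowerSeries K))).order = m := by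
    rw [PowerSeries.order_eq_nat] at hax ⊢
    simpa only [axisHom_apply, PowerSeries.coeff_map, ne_eq, residue_eq_zero_iff] using hax
  have hres0 : (coords c p).map (IsLocalRing.residue (PowerSeries K)) ≠ 0 := by
    rw [← PowerSeries.order_finite_iff_ne_zero, hres]
    exact ENat.natCast_lt_top m
  obtain ⟨P, h, H⟩ := PowerSeries.exists_isWeierstrassFactorization hres0
  have hdeg := H.natDegree_eq_toNat_order_map
  rw [hres, ENat.toNat_natCast] at hdeg
  have hassoc : Associated (coords c p) (P : PowerSeries (PowerSeries K)) := by
    rw [H.eq_mul]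
    exact (associated_mul_isUnit_left_iff H.isUnit).2 (Associated.refl _)
  have hirrP : Irreducible (P : PowerSeries (PowerSeries K)) := by
    rw [← hassoc.irreducible_iff, MulEquiv.irreducible_iff]
    exact hp.2
  have hP := H.isDistinguishedAt
  refine ⟨P, hP, ?_, ?_, hassoc⟩
  · rw [IrreducibleOverFrac, ← hP.monic.irreducible_iff_irreducible_map_fraction_map]
    -- A monic factor of a distinguished polynomial reduces to a power of the variable; if it is
    -- also a unit power series, the exponent is 0. Irreducibility thus passes from power series to
    -- polynomials.
    have key : ∀ f g : Polynomial (PowerSeries K), f.Monic → f * g = P →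
        IsUnit (f : PowerSeries (PowerSeries K)) → f = 1 := by
      intro f g hf hfg hu
      have h1 : Polynomial.map (IsLocalRing.residue (PowerSeries K)) f ∣ Polynomial.X ^ P.natDegree := by
        have := hP.map_eq_X_pow
        have h2 : Polynomial.map (IsLocalRing.residue (PowerSeries K)) P =
          Polynomial.X ^ P.natDegree := this
        rw [← h2, ← hfg, Polynomial.map_mul]
        exact dvd_mul_right _ _
      obtain ⟨i, -, hi⟩ := (dvd_prime_pow Polynomial.prime_X _).1 h1
      have h3 := Polynomial.eq_of_monic_of_associated (hf.map _) (Polynomial.monic_X_pow i) hi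
      have h4 : f.natDegree = i := by
        rw [← hf.natDegree_map (IsLocalRing.residue (PowerSeries K)), h3,
          Polynomial.natDegree_X_pow]
      rcases Nat.eq_zero_or_pos i with h5 | h5
      · exact hf.natDegree_eq_zero.1 (h4.trans h5)
      · exfalso
        have h6 := congrArg (fun q => Polynomial.coeff q 0) h3
        rw [PowerSeries.isUnit_iff_constantCoeff, PowerSeries.isUnit_iff_constantCoeff,
          isUnit_iff_ne_zero, Polynomial.constantCoeff_coe, ne_eq, ← residue_eq_zero_iff] at hu
        apply hu
        simpa [Polynomial.coeff_X_pow, h5.ne] using h6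
    rw [Polynomial.irreducible_of_monic hP.monic (by
      rintro rfl
      exact hirrP.not_isUnit (by simp))]
    intro f g hf hg hfg
    rcases hirrP.isUnit_or_isUnit (by rw [← hfg, Polynomial.coe_mul]) with hu | hu
    · exact Or.inl (key f g hf hfg hu)
    · exact Or.inr (key g f hg (by rw [mul_comm, hfg]) hu)
  · rw [hdeg, mult, hord]

instance isDomain_powerSeries_fin_two : IsDomain (MvPowerSeries (Fin 2) K) :=
  NoZeroDivisors.to_isDomain _

instance uniqueFactorizationMonoid_powerSeries_fin_two :
    UniqueFactorizationMonoid (MvPowerSeries (Fin 2) K) :=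
  (coords (0 : K)).symm.toMulEquiv.uniqueFactorizationMonoid inferInstance

theorem mult_eq_of_associated {p q : MvPowerSeries (Fin 2) K} (h : Associated p q) :
    mult p = mult q := by
  obtain ⟨u, rfl⟩ := h
  have hu : (u : MvPowerSeries (Fin 2) K).order = 0 := by
    by_contra h
    rw [← ne_eq, MvPowerSeries.order_ne_zero_iff_constCoeff_eq_zero] at h
    exact (isUnit_iff_constantCoeff_ne_zero _).1 u.isUnit h
  rw [mult, mult, MvPowerSeries.order_mul, hu, add_zero]

theorem intersectionNumber_eq_of_associated {p q w v : MvPowerSeries (Fin 2) K}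
    (h : Associated p q) (h' : Associated w v) :
    intersectionNumber p w = intersectionNumber q v := by
  have : Ideal.span {p, w} = Ideal.span {q, v} := by
    rw [Ideal.span_insert, Ideal.span_insert, Ideal.span_singleton_eq_span_singleton.2 h,
      Ideal.span_singleton_eq_span_singleton.2 h']
  rw [intersectionNumber, intersectionNumber, this]

theorem branchContact_eq_of_associated {p q w v : MvPowerSeries (Fin 2) K}
    (h : Associated p q) (h' : Associated w v) : branchContact p w = branchContact q v := by
  rw [branchContact, branchContact, intersectionNumber_eq_of_associated h h',
    mult_eq_of_associated h, mult_eq_of_associated h']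

theorem IsBranch.of_associated {p q : MvPowerSeries (Fin 2) K} (hp : IsBranch p)
    (h : Associated p q) : IsBranch q :=
  isBranch_of_irreducible (h.irreducible hp.2)

theorem IsSmoothBranch.of_associated {p q : MvPowerSeries (Fin 2) K} (hp : IsSmoothBranch p)
    (h : Associated p q) : IsSmoothBranch q :=
  ⟨hp.1.of_associated h, by rw [← mult_eq_of_associated h, hp.2]⟩

theorem IsComponent.associated {p q : MvPowerSeries (Fin 2) K} (h : IsComponent q p)
    (hp : IsBranch p) : Associated q p :=
  h.1.2.associated_of_dvd hp.2 h.2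

theorem IsBranch.isComponent_self {p : MvPowerSeries (Fin 2) K} (hp : IsBranch p) :
    IsComponent p p := ⟨hp, dvd_rfl⟩

theorem contact_eq_iInf (f : MvPowerSeries (Fin 2) K) {w : MvPowerSeries (Fin 2) K}
    (hw : IsBranch w) : contact f w =
      ⨅ (p : MvPowerSeries (Fin 2) K) (_ : IsComponent p f), branchContact p w := by
  refine iInf_congr fun p => iInf_congr fun hp => le_antisymm ?_ ?_
  · exact iInf₂_le (f := fun q (_ : IsComponent q w) => branchContact p q) w hw.isComponent_self
  · refine le_iInf₂ fun q hq => ?_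
    rw [branchContact_eq_of_associated (Associated.refl p) (hq.associated hw)]

theorem contact_eq_branchContact {p w : MvPowerSeries (Fin 2) K} (hp : IsBranch p)
    (hw : IsBranch w) : contact p w = branchContact p w := by
  rw [contact_eq_iInf p hw]
  refine le_antisymm (iInf₂_le (f := fun q (_ : IsComponent q p) => branchContact q w) p
    hp.isComponent_self) (le_iInf₂ fun q hq => ?_)
  rw [branchContact_eq_of_associated (hq.associated hp) (Associated.refl w)]

/-! ### Initial forms, tangents, and intersection with smooth branches. -/

/-- Evaluation of the linear initial form of a smooth branch. -/
theorem exists_linear_form {w : MvPowerSeries (Fin 2) K} (hw : w.order = 1) :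
    ∃ a b : K, (a ≠ 0 ∨ b ≠ 0) ∧ ∀ v : Fin 2 → K,
      MvPolynomial.eval v (initialForm w) = a * v 0 + b * v 1 := by
  have h1 : w.order.toNat = 1 := by rw [hw]; rfl
  refine ⟨MvPowerSeries.coeff (Finsupp.single 0 1) w, MvPowerSeries.coeff (Finsupp.single 1 1) w,
    ?_, fun v => ?_⟩
  · obtain ⟨⟨d, hd, hdeg⟩, -⟩ := MvPowerSeries.order_eq_nat.1 (show w.order = (1 : ℕ) from hw)
    have hdd : d 0 + d 1 = 1 := by
      rw [← Fin.sum_univ_two d, ← Finsupp.degree_eq_sum, hdeg]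
    rw [← finsupp_fin_two d] at hd
    rcases Nat.eq_zero_or_pos (d 0) with h | h
    · right
      have h2 : d 1 = 1 := by omega
      rw [h, h2] at hd
      simpa using hd
    · left
      have h2 : d 0 = 1 := by omega
      have h3 : d 1 = 0 := by omega
      rw [h2, h3] at hd
      simpa using hd
  · rw [initialForm, h1, Finset.Nat.antidiagonal_succ]
    simp [MvPolynomial.eval_monomial]
    ring

theorem exists_smul_of_linear_form {a b : K} (hab : a ≠ 0 ∨ b ≠ 0) {u v : Fin 2 → K}
    (hu : u ≠ 0) (hv : a * v 0 + b * v 1 = 0) (hu' : a * u 0 + b * u 1 = 0) :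
    ∃ t : K, v = t • u := by
  rcases hab with h | h
  · have h0 : ∀ x : Fin 2 → K, a * x 0 + b * x 1 = 0 → x 0 = -(b / a) * x 1 := by
      intro x hx
      field_simp
      linear_combination hx
    have hu1 : u 1 ≠ 0 := by
      intro h1
      apply hu
      funext i
      fin_cases i
      · simpa [h1] using h0 u hu'
      · exact h1
    refine ⟨v 1 / u 1, ?_⟩
    funext i
    fin_cases i
    · simp only [Fin.zero_eta, Pi.smul_apply, smul_eq_mul]
      rw [h0 v hv, h0 u hu']
      field_simp
    · simp only [Fin.mk_one, Pi.smul_apply, smul_eq_mul]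
      field_simp
  · have h0 : ∀ x : Fin 2 → K, a * x 0 + b * x 1 = 0 → x 1 = -(a / b) * x 0 := by
      intro x hx
      field_simp
      linear_combination hx
    have hu1 : u 0 ≠ 0 := by
      intro h1
      apply hu
      funext i
      fin_cases i
      · exact h1
      · simpa [h1] using h0 u hu'
    refine ⟨v 0 / u 0, ?_⟩
    funext i
    fin_cases i
    · simp only [Fin.zero_eta, Pi.smul_apply, smul_eq_mul]
      field_simp
    · simp only [Fin.mk_one, Pi.smul_apply, smul_eq_mul]
      rw [h0 v hv, h0 u hu']
      field_simp

/-- The dehomogenized initial form is a nonzero polynomial in `c`, so it has a non-root in an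
infinite field. -/
theorem exists_eval_initialForm_ne_zero [Infinite K] {f : MvPowerSeries (Fin 2) K} (hf : f ≠ 0) :
    ∃ c : K, MvPolynomial.eval ![1, c] (initialForm f) ≠ 0 := by
  set q : Polynomial K := ∑ ij ∈ Finset.HasAntidiagonal.antidiagonal f.order.toNat,
    Polynomial.monomial ij.2
      (MvPowerSeries.coeff (Finsupp.single 0 ij.1 + Finsupp.single 1 ij.2) f) with hq
  have hev : ∀ c, q.eval c = MvPolynomial.eval ![1, c] (initialForm f) := by
    intro c
    rw [hq, initialForm, Polynomial.eval_finsetSum, map_sum]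
    refine Finset.sum_congr rfl fun ij _ => ?_
    rw [Polynomial.eval_monomial, MvPolynomial.eval_monomial,
      Finsupp.prod_fintype _ _ (fun i => pow_zero _), Fin.prod_univ_two]
    simp
  have hq0 : q ≠ 0 := by
    obtain ⟨d, hd, hdeg⟩ := MvPowerSeries.exists_coeff_ne_zero_and_order
      (MvPowerSeries.ne_zero_iff_order_finite.1 hf)
    have hdd : d 0 + d 1 = f.order.toNat := by
      rw [← hdeg, Finsupp.degree_eq_sum, Fin.sum_univ_two]
      rfl
    intro h
    apply hd
    have h1 := congrArg (fun r => Polynomial.coeff r (d 1)) h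
    simp only [hq, Polynomial.finsetSum_coeff, Polynomial.coeff_zero,
      Polynomial.coeff_monomial] at h1
    rw [Finset.sum_eq_single (d 0, d 1), if_pos rfl, finsupp_fin_two] at h1
    · exact h1
    · intro b hb hne
      rw [if_neg]
      intro hbd
      apply hne
      have := Finset.HasAntidiagonal.mem_antidiagonal.1 hb
      ext
      · change b.1 = d 0
        omega
      · exact hbd
    · intro h'
      exact absurd (Finset.HasAntidiagonal.mem_antidiagonal.2 hdd) h'
  obtain ⟨c, hc⟩ := Polynomial.exists_eval_ne_zero_of_natDegree_lt_card q hq0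
    (Cardinal.natCast_lt_aleph0.trans_le (Cardinal.aleph0_le_mk K))
  exact ⟨c, by rwa [← hev]⟩

theorem IsLocalParam.order_eq_iff {ψ : MvPowerSeries (Fin 2) K →ₐ[K] PowerSeries K}
    (hψ : IsLocalParam ψ) {f : MvPowerSeries (Fin 2) K} (hf : f ≠ 0) :
    (ψ f).order = f.order ↔ MvPolynomial.eval (tangentVector ψ) (initialForm f) ≠ 0 := by
  have hord := MvPowerSeries.ne_zero_iff_order_finite.1 hf
  rw [← hψ.coeff_order hf]
  constructor
  · intro h
    rw [← hord, PowerSeries.order_eq_nat] at h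
    exact h.1
  · intro h
    refine le_antisymm ?_ (hψ.order_le f)
    rw [← hord]
    exact PowerSeries.order_le _ h

theorem exists_localParam_tangentVector {v : Fin 2 → K} (hv : v ≠ 0) :
    ∃ ψ : MvPowerSeries (Fin 2) K →ₐ[K] PowerSeries K, IsLocalParam ψ ∧
      ∃ s : K, s ≠ 0 ∧ v = s • tangentVector ψ := by
  rcases eq_or_ne (v 0) 0 with h | h
  · have h1 : v 1 ≠ 0 := by
      intro h1
      apply hv
      funext i
      fin_cases i
      · exact h
      · exact h1
    have hz : PowerSeries.constantCoeff (0 : PowerSeries K) = 0 := map_zero _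
    refine ⟨graphHom 0 hz, isLocalParam_graphHom _ _, v 1, h1, ?_⟩
    rw [tangentVector_graphHom]
    funext i
    fin_cases i
    · simp [h]
    · simp
  · refine ⟨axisHom (v 1 / v 0), isLocalParam_axisHom _, v 0, h, ?_⟩
    rw [tangentVector_axisHom]
    funext i
    fin_cases i
    · simp
    · simp [mul_div_cancel₀ _ h]

/-- Nonvanishing at `v` means that a parametrization in direction `v` preserves the order. Orders
are additive, and two inequalities between finite orders that add up to an equality are equalities.
-/
theorem eval_initialForm_mul_eq_zero_iff {f g : MvPowerSeries (Fin 2) K} (hf : f ≠ 0)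
    (hg : g ≠ 0) {v : Fin 2 → K} (hv : v ≠ 0) :
    MvPolynomial.eval v (initialForm (f * g)) = 0 ↔
      MvPolynomial.eval v (initialForm f) = 0 ∨ MvPolynomial.eval v (initialForm g) = 0 := by
  obtain ⟨ψ, hψ, s, hs, rfl⟩ := exists_localParam_tangentVector hv
  simp only [eval_smul_initialForm, mul_eq_zero, pow_ne_zero _ hs, false_or]
  rw [← not_iff_not, not_or, ← ne_eq, ← ne_eq, ← ne_eq, ← hψ.order_eq_iff hf,
    ← hψ.order_eq_iff hg, ← hψ.order_eq_iff (mul_ne_zero hf hg), map_mul, PowerSeries.order_mul,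
    MvPowerSeries.order_mul]
  have h1 := hψ.order_le f
  have h2 := hψ.order_le g
  have h3 := MvPowerSeries.ne_zero_iff_order_finite.1 hf
  have h4 := MvPowerSeries.ne_zero_iff_order_finite.1 hg
  constructor
  · intro h
    have h5 : f.order ≠ ⊤ := by rw [← h3]; exact ENat.natCast_ne_top _
    have h6 : g.order ≠ ⊤ := by rw [← h4]; exact ENat.natCast_ne_top _
    constructor
    · by_contra hne
      exact (ENat.add_lt_add_of_lt_of_le h6 (lt_of_le_of_ne h1 (Ne.symm hne)) h2).ne' h
    · by_contra hne
      exact (ENat.add_lt_add_of_le_of_lt h5 h1 (lt_of_le_of_ne h2 (Ne.symm hne))).ne' h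
  · rintro ⟨h, h'⟩
    rw [h, h']

theorem IsComponent.eval_initialForm_ne_zero {p f : MvPowerSeries (Fin 2) K}
    (h : IsComponent p f) (hf : f ≠ 0) {v : Fin 2 → K} (hv : v ≠ 0)
    (hfv : MvPolynomial.eval v (initialForm f) ≠ 0) :
    MvPolynomial.eval v (initialForm p) ≠ 0 := by
  obtain ⟨g, rfl⟩ := h.2
  intro h0
  exact hfv ((eval_initialForm_mul_eq_zero_iff (left_ne_zero_of_mul hf)
    (right_ne_zero_of_mul hf) hv).2 (Or.inl h0))

theorem IsSmoothBranch.exists_graph {w : MvPowerSeries (Fin 2) K} (hw : IsSmoothBranch w) {c : K}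
    (hc : MvPolynomial.eval ![1, c] (initialForm w) ≠ 0) :
    ∃ φ : PowerSeries K, PowerSeries.constantCoeff φ = 0 ∧ Associated w (graphEquation c φ) := by
  obtain ⟨P, hP, -, hdeg, hassoc⟩ := hw.1.exists_polynomial hc
  rw [hw.2] at hdeg
  have hdeg' : P.natDegree = 1 := by exact_mod_cast hdeg
  have hPX := hP.monic.eq_X_add_C hdeg'
  refine ⟨-P.coeff 0, ?_, ?_⟩
  · have := hP.mem (n := 0) (by rw [hdeg']; exact one_pos)
    rw [mem_maximalIdeal_iff] at this
    rw [map_neg, this, neg_zero]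
  · have h1 : P = Polynomial.X - Polynomial.C (-P.coeff 0) := by
      rw [Polynomial.C_neg, sub_neg_eq_add]
      exact hPX
    have h2 := hassoc.map (coords c).symm
    rw [AlgEquiv.symm_apply_apply] at h2
    rw [graphEquation, ← h1]
    exact h2

theorem IsSmoothBranch.exists_parametrization [Infinite K] {w : MvPowerSeries (Fin 2) K}
    (hw : IsSmoothBranch w) : ∃ ψ : MvPowerSeries (Fin 2) K →ₐ[K] PowerSeries K,
      IsParametrization ψ w ∧ IsLocalParam ψ ∧ tangentVector ψ ≠ 0 := by
  obtain ⟨c, hc⟩ := exists_eval_initialForm_ne_zero hw.1.1.1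
  obtain ⟨φ, hφ, ha⟩ := hw.exists_graph hc
  exact ⟨graphHom c hφ, (isParametrization_graphHom c hφ).of_associated ha.symm,
    isLocalParam_graphHom c hφ, tangentVector_graphHom_ne_zero c hφ⟩

theorem IsParametrization.eval_initialForm_eq_zero
    {ψ : MvPowerSeries (Fin 2) K →ₐ[K] PowerSeries K} {w : MvPowerSeries (Fin 2) K}
    (h : IsParametrization ψ w) (hψ : IsLocalParam ψ) (hw : w ≠ 0) :
    MvPolynomial.eval (tangentVector ψ) (initialForm w) = 0 := by
  rw [← hψ.coeff_order hw, (h.eq_zero_iff w).2 dvd_rfl, map_zero]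

/-- The multiplicity bounds the intersection number with a smooth branch, with equality if and only
if the tangents differ. -/
theorem intersectionNumber_smooth [Infinite K] {f w : MvPowerSeries (Fin 2) K} (hf : f ≠ 0)
    (hw : IsSmoothBranch w) {v : Fin 2 → K} (hv : v ≠ 0)
    (hwv : MvPolynomial.eval v (initialForm w) = 0) :
    mult f ≤ intersectionNumber f w ∧
    (intersectionNumber f w = mult f ↔ MvPolynomial.eval v (initialForm f) ≠ 0) := by
  obtain ⟨ψ, hψw, hψ, ht⟩ := hw.exists_parametrization
  obtain ⟨a, b, hab, hlin⟩ := exists_linear_form hw.2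
  have h0 := hψw.eval_initialForm_eq_zero hψ hw.1.1.1
  rw [hlin] at h0 hwv
  obtain ⟨t, rfl⟩ := exists_smul_of_linear_form hab ht hwv h0
  have ht0 : t ≠ 0 := by
    rintro rfl
    simp at hv
  rw [hψw.intersectionNumber_eq]
  refine ⟨hψ.order_le f, ?_⟩
  rw [eval_smul_initialForm, mul_ne_zero_iff, ← hψ.order_eq_iff hf]
  exact ⟨fun h => ⟨pow_ne_zero _ ht0, h⟩, fun h => h.2⟩

theorem mult_le_intersectionNumber [Infinite K] {f w : MvPowerSeries (Fin 2) K} (hf : f ≠ 0)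
    (hw : IsSmoothBranch w) : mult f ≤ intersectionNumber f w := by
  obtain ⟨ψ, hψw, hψ, ht⟩ := hw.exists_parametrization
  exact (intersectionNumber_smooth hf hw ht
    (hψw.eval_initialForm_eq_zero hψ hw.1.1.1)).1

/-- If `(1, c)` is tangent to `w`, then `w` is transversal to every curve not tangent to `(1, c)`;
otherwise the Weierstrass polynomial of `w` has degree 1 and displays `w` as a graph. -/
theorem IsSmoothBranch.transversal_or_graph [Infinite K] {w : MvPowerSeries (Fin 2) K}
    (hw : IsSmoothBranch w) (c : K) :
    (∀ f : MvPowerSeries (Fin 2) K, f ≠ 0 → MvPolynomial.eval ![1, c] (initialForm f) ≠ 0 →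
      intersectionNumber f w = mult f) ∨
    ∃ φ : PowerSeries K, PowerSeries.constantCoeff φ = 0 ∧ Associated w (graphEquation c φ) := by
  by_cases h : MvPolynomial.eval ![1, c] (initialForm w) = 0
  · left
    intro f hf hfc
    refine (intersectionNumber_smooth hf hw (v := ![1, c]) ?_ h).2.2 hfc
    intro h'
    simpa using congrFun h' 0
  · exact Or.inr (hw.exists_graph h)

theorem IsBranch.exists_polynomial_order {p : MvPowerSeries (Fin 2) K} (hp : IsBranch p) {c : K}
    (hc : MvPolynomial.eval ![1, c] (initialForm p) ≠ 0) :
    ∃ P : Polynomial (PowerSeries K), P.Monic ∧ IrreducibleOverFrac P ∧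
      (P.natDegree : ℕ∞) = mult p ∧ ∀ φ : PowerSeries K, PowerSeries.constantCoeff φ = 0 →
        intersectionNumber p (graphEquation c φ) = (P.eval φ).order := by
  obtain ⟨P, hP, hirr, hdeg, h⟩ := hp.exists_polynomial hc
  refine ⟨P, hP.monic, hirr, hdeg, fun φ hφ => ?_⟩
  rw [(isParametrization_graphHom c hφ).intersectionNumber_eq, graphHom_apply]
  obtain ⟨u, hu⟩ := h
  rw [← evalAt_coe (mem_of_constantCoeff_eq_zero hφ), ← hu, map_mul, PowerSeries.order_mul,
    PowerSeries.order_zero_of_unit (u.isUnit.map _), add_zero]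

/-! ### Orders of contact as fractions with a fixed denominator. -/

theorem strictMono_natCast_div {n : ℕ} (hn : n ≠ 0) :
    StrictMono fun x : ℕ∞ => (x : ℝ≥0∞) / (n : ℝ≥0∞) := by
  intro x y h
  have h' : (x : ℝ≥0∞) < (y : ℝ≥0∞) := ENat.toENNReal_lt.2 h
  exact ENNReal.div_lt_div_right (by simpa using hn) (ENNReal.natCast_ne_top n) h'

theorem natCast_eq_div {n : ℕ} (hn : n ≠ 0) (N : ℕ) :
    (N : ℝ≥0∞) = (((n * N : ℕ) : ℕ∞) : ℝ≥0∞) / (n : ℝ≥0∞) := by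
  rw [ENat.toENNReal_coe, Nat.cast_mul, mul_comm]
  exact (ENNReal.mul_div_cancel_right (by simpa using hn) (ENNReal.natCast_ne_top n)).symm

theorem natCast_div_eq_div {m : ℕ} (n : ℕ) (hm : m ≠ 0) (x : ℕ∞) :
    (x : ℝ≥0∞) / (n : ℝ≥0∞) = ((x * m : ℕ∞) : ℝ≥0∞) / ((n * m : ℕ) : ℝ≥0∞) := by
  rw [ENat.toENNReal_mul, Nat.cast_mul, ENat.toENNReal_coe]
  exact (ENNReal.mul_div_mul_right _ _ (by simpa using hm) (ENNReal.natCast_ne_top m)).symm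

theorem exists_min_of_denominator {ι : Type*} [Nonempty ι] {M : ℕ} (F : ι → ℝ≥0∞)
    (h : ∀ i, ∃ k : ℕ∞, F i = (k : ℝ≥0∞) / (M : ℝ≥0∞)) : ∃ i, ∀ j, F i ≤ F j := by
  choose k hk using h
  refine ⟨Function.argmin k, fun j => ?_⟩
  rw [hk, hk]
  have : (k (Function.argmin k) : ℝ≥0∞) ≤ k j :=
    ENat.toENNReal_le.2 (Function.argmin_le k j)
  gcongr

theorem exists_max_of_denominator {ι : Type*} [Nonempty ι] {M : ℕ} (hM : M ≠ 0) (F : ι → ℝ≥0∞)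
    (h : ∀ i, ∃ k : ℕ∞, F i = (k : ℝ≥0∞) / (M : ℝ≥0∞)) (B : ℕ) (hB : ∀ i, F i ≤ B) :
    ∃ i, ∀ j, F j ≤ F i := by
  choose k hk using h
  have hmono := strictMono_natCast_div hM
  have hkB : ∀ i, k i ≤ (M * B : ℕ) := by
    intro i
    have := hB i
    rw [hk, natCast_eq_div hM B] at this
    exact hmono.le_iff_le.1 this
  have hfin : (Set.range k).Finite := ((Set.finite_Iic (M * B)).image
      (Nat.cast : ℕ → ℕ∞)).subset (by
    rintro _ ⟨i, rfl⟩
    obtain ⟨m, hm⟩ := ENat.ne_top_iff_exists.1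
      (((hkB i).trans_lt (ENat.natCast_lt_top _)).ne)
    refine ⟨m, ?_, hm⟩
    have := hkB i
    rw [← hm, Nat.cast_le] at this
    exact this)
  obtain ⟨_, ⟨i, rfl⟩, hi⟩ := Set.exists_max_image (Set.range k) id hfin (Set.range_nonempty k)
  refine ⟨i, fun j => ?_⟩
  rw [hk, hk]
  exact hmono.monotone (hi _ ⟨j, rfl⟩)

theorem branchContact_eq_div {p w : MvPowerSeries (Fin 2) K} (hw : IsSmoothBranch w) {n : ℕ}
    (hn : mult p = n) :
    branchContact p w = (intersectionNumber p w : ℝ≥0∞) / (n : ℝ≥0∞) := by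
  rw [branchContact, hw.2, hn]
  simp

theorem IsCurve.exists_mult_eq {p : MvPowerSeries (Fin 2) K} (hp : IsCurve p) :
    ∃ n : ℕ, n ≠ 0 ∧ mult p = n := by
  have h := MvPowerSeries.ne_zero_iff_order_finite.1 hp.1
  refine ⟨p.order.toNat, fun h0 => ?_, h.symm⟩
  have h1 := hp.one_le_order
  rw [← h, h0] at h1
  simp at h1

/-! ### Tangents, rigidity and limits of contact for branches. -/

theorem eq_smul_graph_direction {v : Fin 2 → K} {c : K} (hs : v 1 - c * v 0 ≠ 0) :
    v = (v 1 - c * v 0) • ![v 0 / (v 1 - c * v 0), 1 + c * (v 0 / (v 1 - c * v 0))] := by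
  funext i
  fin_cases i
  · simp [mul_div_cancel₀ _ hs]
  · simp only [Fin.mk_one, Pi.smul_apply, Matrix.cons_val_one, smul_eq_mul,
      Matrix.cons_val_fin_one]
    field_simp
    ring

/-- A tangent is never `(1, c)`, so it is the direction of a linear graph `φ = a t`, and tangency
pushes the intersection number above the multiplicity. -/
theorem IsBranch.exists_graph_of_tangent {p : MvPowerSeries (Fin 2) K} (hp : IsBranch p) {c : K}
    (hc : MvPolynomial.eval ![1, c] (initialForm p) ≠ 0) {v : Fin 2 → K} (hv : v ≠ 0)
    (hpv : MvPolynomial.eval v (initialForm p) = 0) :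
    ∃ s a : K, s ≠ 0 ∧ v = s • ![a, 1 + c * a] ∧
      mult p < intersectionNumber p (graphEquation c (PowerSeries.C a * PowerSeries.X)) := by
  have hs : v 1 - c * v 0 ≠ 0 := by
    intro h
    have hv' : v = v 0 • ![1, c] := by
      funext i
      fin_cases i
      · simp
      · simp only [Fin.mk_one, Pi.smul_apply, Matrix.cons_val_one, smul_eq_mul,
          Matrix.cons_val_fin_one]
        linear_combination h
    have hv0 : v 0 ≠ 0 := by
      intro h0
      rw [h0, zero_smul] at hv'
      exact hv hv'
    rw [hv', eval_smul_initialForm, mul_eq_zero] at hpv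
    exact hpv.elim (pow_ne_zero _ hv0) hc
  have hva := eq_smul_graph_direction hs
  have hz : PowerSeries.constantCoeff
      (PowerSeries.C (v 0 / (v 1 - c * v 0)) * PowerSeries.X : PowerSeries K) = 0 := by simp
  refine ⟨_, _, hs, hva, ?_⟩
  rw [(isParametrization_graphHom c hz).intersectionNumber_eq]
  have hL := isLocalParam_graphHom c hz
  refine lt_of_le_of_ne (hL.order_le p) fun h => (hL.order_eq_iff hp.1.1).1 h.symm ?_
  rw [tangentVector_graphHom]
  rw [hva, eval_smul_initialForm, mul_eq_zero] at hpv
  simpa using hpv.resolve_left (pow_ne_zero _ hs)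

theorem exists_isComponent_dvd {f g : MvPowerSeries (Fin 2) K} (hf : f ≠ 0) (hg : ¬ IsUnit g)
    (hgf : g ∣ f) : ∃ q, IsComponent q f ∧ q ∣ g := by
  obtain ⟨q, hq, hqg⟩ := WfDvdMonoid.exists_irreducible_factor hg (ne_zero_of_dvd_ne_zero hf hgf)
  exact ⟨q, ⟨isBranch_of_irreducible hq, hqg.trans hgf⟩, hqg⟩

theorem IsCurve.exists_isComponent {f : MvPowerSeries (Fin 2) K} (hf : IsCurve f) :
    ∃ p, IsComponent p f := by
  have hfu : ¬ IsUnit f := by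
    rw [isUnit_iff_constantCoeff_ne_zero, not_not]
    exact hf.2
  obtain ⟨p, hp, -⟩ := exists_isComponent_dvd hf.1 hfu dvd_rfl
  exact ⟨p, hp⟩

section Branch

variable [Infinite K]

/-- A branch has exactly one tangent. -/
theorem IsBranch.tangent_unique {p : MvPowerSeries (Fin 2) K} (hp : IsBranch p)
    {u v : Fin 2 → K} (hu : u ≠ 0) (hv : v ≠ 0)
    (hpu : MvPolynomial.eval u (initialForm p) = 0)
    (hpv : MvPolynomial.eval v (initialForm p) = 0) : ∃ t : K, v = t • u := by
  obtain ⟨c, hc⟩ := exists_eval_initialForm_ne_zero hp.1.1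
  obtain ⟨P, hP, hirr, hdeg, hint⟩ := hp.exists_polynomial_order hc
  obtain ⟨s, a, hs, hua, h1⟩ := hp.exists_graph_of_tangent hc hu hpu
  obtain ⟨s', b, hs', hvb, h2⟩ := hp.exists_graph_of_tangent hc hv hpv
  -- Distinct slopes give `n · ord(ψ - φ) = n`, while both values of `P` have order above `n`,
  -- against the isosceles property.
  have hab : a = b := by
    by_contra hab
    rw [hint _ (by simp)] at h1 h2
    have h3 := min_order_eval_eq hP hirr (PowerSeries.C a * PowerSeries.X)
      (PowerSeries.C b * PowerSeries.X)
    have h4 : (PowerSeries.C b * PowerSeries.X - PowerSeries.C a * PowerSeries.X :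
        PowerSeries K).order = 1 := by
      rw [← sub_mul, ← map_sub, PowerSeries.order_mul, PowerSeries.order_X]
      have : (PowerSeries.C (b - a) : PowerSeries K).order = 0 := by
        apply PowerSeries.order_zero_of_unit
        rw [PowerSeries.isUnit_iff_constantCoeff, PowerSeries.constantCoeff_C]
        exact (sub_ne_zero.2 (Ne.symm hab)).isUnit
      rw [this, zero_add]
    rw [h4, nsmul_eq_mul, mul_one, hdeg, min_eq_right h1.le] at h3
    exact (lt_min h1 h2).ne' h3
  refine ⟨s' / s, ?_⟩
  rw [hua, hvb, hab, smul_smul, div_mul_cancel₀ _ hs]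

/-- A smooth branch with a non-integral order of contact has maximal contact. -/
theorem IsBranch.intersectionNumber_le_of_not_dvd {p w w' : MvPowerSeries (Fin 2) K}
    (hp : IsBranch p) (hw : IsSmoothBranch w) (hw' : IsSmoothBranch w') {n a : ℕ}
    (hn : mult p = n) (ha : intersectionNumber p w = a) (hna : ¬ n ∣ a) :
    intersectionNumber p w' ≤ intersectionNumber p w := by
  obtain ⟨c, hc⟩ := exists_eval_initialForm_ne_zero hp.1.1
  obtain ⟨P, hP, hirr, hdeg, hint⟩ := hp.exists_polynomial_order hc
  rw [hn, Nat.cast_inj] at hdeg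
  rcases hw'.transversal_or_graph c with h' | ⟨ψ, hψ, h'⟩
  · rw [h' p hp.1.1 hc]
    exact mult_le_intersectionNumber hp.1.1 hw
  rcases hw.transversal_or_graph c with h | ⟨φ, hφ, h⟩
  · exfalso
    have := h p hp.1.1 hc
    rw [ha, hn, Nat.cast_inj] at this
    exact hna this.symm.dvd
  rw [intersectionNumber_eq_of_associated (Associated.refl p) h, hint φ hφ] at ha ⊢
  rw [intersectionNumber_eq_of_associated (Associated.refl p) h', hint ψ hψ]
  -- If `ψ` did better than `φ`, the isosceles property would force `ord P(φ) = n · ord(ψ - φ)`, a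
  -- multiple of `n`.
  by_contra! hlt
  have h3 := min_order_eval_eq hP hirr ψ φ
  rw [min_eq_right hlt.le] at h3
  have h5 : P.natDegree • (ψ - φ).order = a := by
    rw [← neg_sub, PowerSeries.order_neg] at h3
    rw [← ha]
    rcases min_choice (P.eval ψ).order (P.natDegree • (ψ - φ).order) with h7 | h7
    · exact absurd (h3.trans h7) hlt.ne
    · exact (h3.trans h7).symm
  rw [hdeg, nsmul_eq_mul] at h5
  have hn0 : (n : ℕ∞) ≠ 0 := by
    rw [← hdeg]
    exact_mod_cast hirr.natDegree_pos.ne'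
  have htop : (ψ - φ).order ≠ ⊤ := by
    intro h8
    rw [h8, ENat.mul_top hn0] at h5
    exact ENat.natCast_ne_top a h5.symm
  obtain ⟨k, hk⟩ := ENat.ne_top_iff_exists.1 htop
  rw [← hk] at h5
  have h8 : n * k = a := by exact_mod_cast h5
  exact hna ⟨k, h8.symm⟩

/-- A sequence of smooth branches with unbounded contact with `f` converges to a smooth branch. -/
theorem isSmoothBranch_of_unbounded {f : MvPowerSeries (Fin 2) K} (hf : IsReducedCurve f)
    (h : ∀ B : ℕ, ∃ w, IsSmoothBranch w ∧ (B : ℝ≥0∞) < contact f w) : IsSmoothBranch f := by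
  obtain ⟨c, hc⟩ := exists_eval_initialForm_ne_zero hf.1.1
  obtain ⟨p, hp⟩ := hf.1.exists_isComponent
  have hcomp : ∀ q, IsComponent q f → MvPolynomial.eval ![1, c] (initialForm q) ≠ 0 := fun q hq =>
    hq.eval_initialForm_ne_zero hf.1.1 (fun h' => by simpa using congrFun h' 0) hc
  have hlt : ∀ B : ℕ, ∃ w, IsSmoothBranch w ∧ ∀ q, IsComponent q f →
      ∀ n : ℕ, mult q = n → ((n * B : ℕ) : ℕ∞) < intersectionNumber q w := by
    intro B
    obtain ⟨w, hw, hB⟩ := h B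
    refine ⟨w, hw, fun q hq n hn => ?_⟩
    rw [contact_eq_iInf f hw.1] at hB
    have h1 := hB.trans_le (iInf₂_le (f := fun q (_ : IsComponent q f) => branchContact q w) q hq)
    obtain ⟨n', hn0, hn'⟩ := hq.1.1.exists_mult_eq
    have : n' = n := by rw [hn', Nat.cast_inj] at hn; exact hn
    subst this
    rw [branchContact_eq_div hw hn, natCast_eq_div hn0 B] at h1
    exact (strictMono_natCast_div hn0).lt_iff_lt.1 h1
  have hgraph : ∀ N : ℕ, ∃ φ : PowerSeries K, PowerSeries.constantCoeff φ = 0 ∧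
      ∀ q, IsComponent q f → ∀ n : ℕ, mult q = n →
        ((n * N : ℕ) : ℕ∞) ≤ intersectionNumber q (graphEquation c φ) := by
    intro N
    -- With `N + 1` the strict lower bound is at least `n`, which excludes the transversal
    -- alternative even for `N = 0`.
    obtain ⟨w, hw, hB⟩ := hlt (N + 1)
    rcases hw.transversal_or_graph c with h' | ⟨φ, hφ, h'⟩
    · exfalso
      obtain ⟨n, hn0, hn⟩ := hp.1.1.exists_mult_eq
      have h1 := hB p hp n hn
      rw [h' p hp.1.1.1 (hcomp p hp), hn, Nat.cast_lt] at h1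
      exact absurd h1 (not_lt.2 (Nat.le_mul_of_pos_right n N.succ_pos))
    · refine ⟨φ, hφ, fun q hq n hn => ?_⟩
      rw [← intersectionNumber_eq_of_associated (Associated.refl q) h']
      refine le_trans ?_ (hB q hq n hn).le
      exact_mod_cast Nat.mul_le_mul_left n N.le_succ
  choose φ hφ hφN using hgraph
  -- Both values of `P` have order at least `n N`, hence so does the third term `n · ord(φ M - φ
  -- N)`.
  have hcauchy : ∀ N M : ℕ, N ≤ M → (N : ℕ∞) ≤ (φ M - φ N).order := by
    intro N M hNM
    obtain ⟨n, hn0, hn⟩ := hp.1.1.exists_mult_eq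
    obtain ⟨P, hP, hirr, hdeg, hint⟩ := hp.1.exists_polynomial_order (hcomp p hp)
    rw [hn, Nat.cast_inj] at hdeg
    have h1 := hφN N p hp n hn
    have h2 := hφN M p hp n hn
    rw [hint _ (hφ _)] at h1 h2
    have h2' : ((n * N : ℕ) : ℕ∞) ≤ (P.eval (φ M)).order :=
      le_trans (by exact_mod_cast Nat.mul_le_mul_left n hNM) h2
    have h3 := min_order_eval_eq hP hirr (φ N) (φ M)
    have h4 := (le_min h1 h2').trans (h3.trans_le (min_le_right _ _))
    rw [hdeg, nsmul_eq_mul, Nat.cast_mul] at h4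
    refine (ENat.mul_le_mul_left_iff ?_ (ENat.natCast_ne_top n)).1 h4
    exact_mod_cast hn0
  -- The coefficient of index `k` is constant along the sequence from `φ (k + 1)` on.
  let Φ : PowerSeries K := PowerSeries.mk fun k => PowerSeries.coeff k (φ (k + 1))
  have hΦ : ∀ N : ℕ, (N : ℕ∞) ≤ (Φ - φ N).order := by
    intro N
    refine PowerSeries.nat_le_order _ _ fun i hi => ?_
    have := PowerSeries.coeff_of_lt_order i
      (lt_of_lt_of_le (by exact_mod_cast Nat.lt_succ_self i) (hcauchy (i + 1) N hi))
    rw [map_sub] at this ⊢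
    rw [PowerSeries.coeff_mk, ← sub_eq_zero.1 this, sub_self]
  have hΦ0 : PowerSeries.constantCoeff Φ = 0 := by
    rw [← PowerSeries.coeff_zero_eq_constantCoeff_apply, PowerSeries.coeff_mk,
      PowerSeries.coeff_zero_eq_constantCoeff_apply]
    exact hφ 1
  -- In the limit the intersection number with each component is infinite, so `q` vanishes along the
  -- limit graph.
  have hall : ∀ q, IsComponent q f → Associated (graphEquation c Φ) q := by
    intro q hq
    obtain ⟨n, hn0, hn⟩ := hq.1.1.exists_mult_eq
    obtain ⟨P, hP, hirr, hdeg, hint⟩ := hq.1.exists_polynomial_order (hcomp q hq)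
    rw [hn, Nat.cast_inj] at hdeg
    have htop : intersectionNumber q (graphEquation c Φ) = ⊤ := by
      rw [hint Φ hΦ0, ENat.eq_top_iff_forall_ge]
      intro N
      have h1 := hφN N q hq n hn
      rw [hint _ (hφ _)] at h1
      have h3 := min_order_eval_eq hP hirr (φ N) Φ
      have h5 : ((n * N : ℕ) : ℕ∞) ≤ P.natDegree • (Φ - φ N).order := by
        rw [hdeg, nsmul_eq_mul, Nat.cast_mul]
        exact mul_le_mul_right (hΦ N) _
      have h4 := (le_min h1 h5).trans (h3.symm.trans_le (min_le_right _ _))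
      refine le_trans ?_ h4
      exact_mod_cast Nat.le_mul_of_pos_left N (Nat.pos_of_ne_zero hn0)
    have hpar := isParametrization_graphHom c hΦ0
    rw [hpar.intersectionNumber_eq, PowerSeries.order_eq_top, hpar.eq_zero_iff] at htop
    exact (isSmoothBranch_graphEquation c hΦ0).1.2.associated_of_dvd hq.1.2 htop
  obtain ⟨g, hg⟩ := hp.2
  by_cases hgu : IsUnit g
  · refine (isSmoothBranch_graphEquation c hΦ0).of_associated ((hall p hp).trans ?_)
    rw [hg]
    exact (associated_mul_isUnit_right_iff hgu).2 (Associated.refl p)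
  -- A further component would also be associated to `p`, so `p * p` would divide the squarefree
  -- `f`.
  · exfalso
    obtain ⟨q, hq, hqg⟩ := exists_isComponent_dvd hf.1.1 hgu ⟨p, by rw [hg, mul_comm]⟩
    have hpq : p ∣ g := (((hall p hp).symm.trans (hall q hq)).dvd).trans hqg
    refine hp.1.2.not_isUnit (hf.2 p ?_)
    rw [hg]
    exact mul_dvd_mul_left p hpq

end Branch

/-- An integral order of contact of a branch with a smooth branch can be improved. -/
theorem IsBranch.exists_intersectionNumber_lt [IsAlgClosed K] {p w : MvPowerSeries (Fin 2) K}
    (hp : IsBranch p) (hw : IsSmoothBranch w) {n N : ℕ} (hn : mult p = n)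
    (hN : intersectionNumber p w = (n * N : ℕ)) :
    ∃ w', IsSmoothBranch w' ∧ intersectionNumber p w < intersectionNumber p w' := by
  obtain ⟨c, hc⟩ := exists_eval_initialForm_ne_zero hp.1.1
  obtain ⟨P, hP, hirr, hdeg, hint⟩ := hp.exists_polynomial_order hc
  have hdegn : P.natDegree = n := by rwa [hn, Nat.cast_inj] at hdeg
  -- Positivity of `N` keeps the perturbed series free of a constant term.
  have hN0 : N ≠ 0 := by
    rintro rfl
    have := mult_le_intersectionNumber hp.1.1 hw
    rw [hN, ← hdeg, mul_zero, Nat.cast_le] at this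
    exact hirr.natDegree_pos.not_ge this
  have improve : ∀ φ : PowerSeries K, PowerSeries.constantCoeff φ = 0 →
      intersectionNumber p (graphEquation c φ) = (n * N : ℕ) →
      ∃ w', IsSmoothBranch w' ∧ ((n * N : ℕ) : ℕ∞) < intersectionNumber p w' := by
    intro φ hφ h
    rw [hint φ hφ, ← hdegn] at h
    obtain ⟨b, hb⟩ := exists_order_eval_lt hP hirr φ N h
    have hz : PowerSeries.constantCoeff (φ + PowerSeries.C b * PowerSeries.X ^ N) = 0 := by
      simp [hφ, hN0]
    refine ⟨graphEquation c _, isSmoothBranch_graphEquation c hz, ?_⟩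
    rwa [hint _ hz, ← hdegn, ← h]
  rw [hN]
  rcases hw.transversal_or_graph c with h | ⟨φ, hφ, h⟩
  -- Here `w` has the least possible intersection number, so the graph of 0 either beats it or ties
  -- with it and can be improved.
  · have h1 := h p hp.1.1 hc
    have hz : PowerSeries.constantCoeff (0 : PowerSeries K) = 0 := map_zero _
    have hs := isSmoothBranch_graphEquation c hz
    have h2 := mult_le_intersectionNumber hp.1.1 hs
    rw [← h1, hN] at h2
    rcases h2.eq_or_lt with h3 | h3
    · exact improve 0 hz h3.symm
    · exact ⟨_, hs, h3⟩
  · rw [intersectionNumber_eq_of_associated (Associated.refl p) h] at hN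
    exact improve φ hφ hN

/-! ### Contact exponents of reduced curves and existence of maximal contact. -/

theorem IsComponent.mult_le {p f : MvPowerSeries (Fin 2) K} (hp : IsComponent p f) :
    mult p ≤ mult f := by
  obtain ⟨g, rfl⟩ := hp.2
  rw [mult, mult, MvPowerSeries.order_mul]
  exact le_self_add

/-- Component multiplicities are at most `m = mult f`, so `m!` serves as common denominator. -/
theorem exists_branchContact_eq_div {f : MvPowerSeries (Fin 2) K} (hf : IsCurve f) :
    ∃ M : ℕ, M ≠ 0 ∧ ∀ p w, IsComponent p f → IsSmoothBranch w →
      ∃ k : ℕ∞, branchContact p w = (k : ℝ≥0∞) / (M : ℝ≥0∞) := by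
  obtain ⟨m, -, hm⟩ := hf.exists_mult_eq
  refine ⟨m.factorial, m.factorial_ne_zero, fun p w hp hw => ?_⟩
  obtain ⟨n, hn0, hn⟩ := hp.1.1.exists_mult_eq
  have hnm : n ≤ m := by
    have := hp.mult_le
    rwa [hn, hm, Nat.cast_le] at this
  obtain ⟨k, hk⟩ := Nat.dvd_factorial (Nat.pos_of_ne_zero hn0) hnm
  have hk0 : k ≠ 0 := by
    rintro rfl
    exact m.factorial_ne_zero hk
  exact ⟨_, by rw [branchContact_eq_div hw hn, natCast_div_eq_div n hk0, hk]⟩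

/-- The contact with a smooth branch is attained at a component. -/
theorem IsCurve.exists_contact_eq {f w : MvPowerSeries (Fin 2) K} (hf : IsCurve f)
    (hw : IsSmoothBranch w) : ∃ p, IsComponent p f ∧ contact f w = branchContact p w := by
  obtain ⟨p₀, hp₀⟩ := hf.exists_isComponent
  have : Nonempty {p // IsComponent p f} := ⟨⟨p₀, hp₀⟩⟩
  obtain ⟨M, -, hM⟩ := exists_branchContact_eq_div hf
  obtain ⟨⟨p, hp⟩, hmin⟩ := exists_min_of_denominator (M := M)
    (fun p : {p // IsComponent p f} => branchContact p.1 w) (fun p => hM p.1 w p.2 hw)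
  refine ⟨p, hp, ?_⟩
  rw [contact_eq_iInf f hw.1]
  exact le_antisymm (iInf₂_le (f := fun q (_ : IsComponent q f) => branchContact q w) p hp)
    (le_iInf₂ fun q hq => hmin ⟨q, hq⟩)

theorem contact_le_branchContact {f p w : MvPowerSeries (Fin 2) K} (hp : IsComponent p f)
    (hw : IsSmoothBranch w) : contact f w ≤ branchContact p w := by
  rw [contact_eq_iInf f hw.1]
  exact iInf₂_le (f := fun q (_ : IsComponent q f) => branchContact q w) p hp

theorem contact_le_contactExponent (f : MvPowerSeries (Fin 2) K) {w : MvPowerSeries (Fin 2) K}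
    (hw : IsSmoothBranch w) : contact f w ≤ contactExponent f :=
  le_iSup₂ (f := fun w (_ : IsSmoothBranch w) => contact f w) w hw

theorem contactExponent_le_of_isComponent {f p : MvPowerSeries (Fin 2) K}
    (hp : IsComponent p f) : contactExponent f ≤ contactExponent p := by
  refine iSup₂_le fun w hw => ?_
  refine le_trans ?_ (contact_le_contactExponent p hw)
  rw [contact_eq_branchContact hp.1 hw.1]
  exact contact_le_branchContact hp hw

theorem exists_isSmoothBranch_tangent {v : Fin 2 → K} (hv : v ≠ 0) :
    ∃ w : MvPowerSeries (Fin 2) K, IsSmoothBranch w ∧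
      MvPolynomial.eval v (initialForm w) = 0 := by
  obtain ⟨c, hc⟩ : ∃ c : K, v 1 - c * v 0 ≠ 0 := by
    by_cases h : v 1 = 0
    · refine ⟨1, fun h' => hv ?_⟩
      rw [h, one_mul, zero_sub, neg_eq_zero] at h'
      funext i
      fin_cases i
      · exact h'
      · exact h
    · exact ⟨0, by simpa using h⟩
  have hz : PowerSeries.constantCoeff
      (PowerSeries.C (v 0 / (v 1 - c * v 0)) * PowerSeries.X : PowerSeries K) = 0 := by simp
  have hw := isSmoothBranch_graphEquation c hz
  refine ⟨_, hw, ?_⟩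
  have h := (isParametrization_graphHom c hz).eval_initialForm_eq_zero
    (isLocalParam_graphHom c hz) hw.1.1.1
  rw [tangentVector_graphHom] at h
  simp only [PowerSeries.coeff_C_mul, PowerSeries.coeff_one_X, mul_one] at h
  have h1 := eval_smul_initialForm (graphEquation c (PowerSeries.C (v 0 / (v 1 - c * v 0)) *
    PowerSeries.X)) (v 1 - c * v 0) ![v 0 / (v 1 - c * v 0), 1 + c * (v 0 / (v 1 - c * v 0))]
  rwa [h, mul_zero, ← eq_smul_graph_direction hc] at h1

theorem exists_isComponent_eval_eq_zero {f : MvPowerSeries (Fin 2) K} (hf : f ≠ 0)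
    {v : Fin 2 → K} (hv : v ≠ 0) (h : MvPolynomial.eval v (initialForm f) = 0) :
    ∃ p, IsComponent p f ∧ MvPolynomial.eval v (initialForm p) = 0 := by
  induction f using WfDvdMonoid.induction_on_irreducible with
  | zero => exact absurd rfl hf
  | unit u hu =>
    exfalso
    obtain ⟨g, hg⟩ := hu.exists_right_inv
    have h1 := (eval_initialForm_mul_eq_zero_iff hf
      (right_ne_zero_of_mul (hg ▸ one_ne_zero)) hv).2 (Or.inl h)
    have h2 : (1 : MvPowerSeries (Fin 2) K).order = 0 := MvPowerSeries.weightedOrder_one _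
    rw [hg, initialForm, h2] at h1
    simp at h1
  | mul a i ha hi ih =>
    rcases (eval_initialForm_mul_eq_zero_iff hi.ne_zero ha hv).1 h with h1 | h1
    · exact ⟨i, ⟨isBranch_of_irreducible hi, dvd_mul_right i a⟩, h1⟩
    · obtain ⟨p, hp, hpv⟩ := ih ha h1
      exact ⟨p, ⟨hp.1, hp.2.mul_left i⟩, hpv⟩

theorem exists_isSmoothBranch : ∃ w : MvPowerSeries (Fin 2) K, IsSmoothBranch w :=
  ⟨graphEquation 0 0, isSmoothBranch_graphEquation 0 (map_zero _)⟩

theorem contactExponent_eq_top_of_isSmoothBranch [Infinite K] {f : MvPowerSeries (Fin 2) K}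
    (hf : IsSmoothBranch f) : contactExponent f = ⊤ := by
  refine top_le_iff.1 (le_trans ?_ (contact_le_contactExponent f hf))
  obtain ⟨ψ, hψ, -, -⟩ := hf.exists_parametrization
  obtain ⟨n, hn0, hn⟩ := hf.1.1.exists_mult_eq
  rw [contact_eq_branchContact hf.1 hf.1, branchContact_eq_div hf hn, hψ.intersectionNumber_eq,
    (hψ.eq_zero_iff f).2 dvd_rfl, PowerSeries.order_zero, ENat.toENNReal_top,
    ENNReal.top_div_of_ne_top (ENNReal.natCast_ne_top n)]

/-- Bounded contacts take finitely many values. Unbounded ones force `f` to be smooth, and then `f`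
has infinite contact with itself. -/
theorem IsReducedCurve.exists_hasMaximalContact [Infinite K] {f : MvPowerSeries (Fin 2) K}
    (hf : IsReducedCurve f) : ∃ w, HasMaximalContact w f := by
  by_cases hB : ∃ B : ℕ, ∀ w, IsSmoothBranch w → contact f w ≤ B
  · obtain ⟨B, hB⟩ := hB
    obtain ⟨w₀, hw₀⟩ := exists_isSmoothBranch (K := K)
    have : Nonempty {w : MvPowerSeries (Fin 2) K // IsSmoothBranch w} := ⟨⟨w₀, hw₀⟩⟩
    obtain ⟨M, hM0, hM⟩ := exists_branchContact_eq_div hf.1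
    obtain ⟨⟨w, hw⟩, hmax⟩ := exists_max_of_denominator hM0
      (fun w : {w : MvPowerSeries (Fin 2) K // IsSmoothBranch w} => contact f w.1) (fun w => by
        obtain ⟨p, hp, h⟩ := hf.1.exists_contact_eq w.2
        rw [h]
        exact hM p w.1 hp w.2) B (fun w => hB w.1 w.2)
    exact ⟨w, hw, le_antisymm (contact_le_contactExponent f hw)
      (iSup₂_le fun w' hw' => hmax ⟨w', hw'⟩)⟩
  · push Not at hB
    have hs := isSmoothBranch_of_unbounded hf hB
    have htop := contactExponent_eq_top_of_isSmoothBranch hs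
    refine ⟨f, hs, ?_⟩
    obtain ⟨ψ, hψ, -, -⟩ := hs.exists_parametrization
    obtain ⟨n, hn0, hn⟩ := hs.1.1.exists_mult_eq
    rw [htop, contact_eq_branchContact hs.1 hs.1, branchContact_eq_div hs hn,
      hψ.intersectionNumber_eq, (hψ.eq_zero_iff f).2 dvd_rfl, PowerSeries.order_zero,
      ENat.toENNReal_top, ENNReal.top_div_of_ne_top (ENNReal.natCast_ne_top n)]

theorem IsBranch.isReducedCurve {p : MvPowerSeries (Fin 2) K} (hp : IsBranch p) :
    IsReducedCurve p := ⟨hp.1, hp.2.squarefree⟩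

theorem IsReducedCurve.contactExponent_eq_top_iff [Infinite K] {f : MvPowerSeries (Fin 2) K}
    (hf : IsReducedCurve f) : contactExponent f = ⊤ ↔ IsSmoothBranch f := by
  refine ⟨fun h => isSmoothBranch_of_unbounded hf fun B => ?_,
    contactExponent_eq_top_of_isSmoothBranch⟩
  obtain ⟨w, hw, hmax⟩ := hf.exists_hasMaximalContact
  exact ⟨w, hw, by rw [hmax, h]; exact ENNReal.natCast_lt_top B⟩

theorem IsReducedCurve.exists_contactExponent_eq [Infinite K] {f : MvPowerSeries (Fin 2) K}
    (hf : IsReducedCurve f) : ∃ w p, IsSmoothBranch w ∧ IsComponent p f ∧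
      contactExponent f = branchContact p w := by
  obtain ⟨w, hw, hmax⟩ := hf.exists_hasMaximalContact
  obtain ⟨p, hp, h⟩ := hf.1.exists_contact_eq hw
  exact ⟨w, p, hw, hp, by rw [← hmax, h]⟩

/-! ### Rationality and the three characterizations. -/

theorem IsReducedCurve.contactExponent_rational [Infinite K] {f : MvPowerSeries (Fin 2) K}
    (hf : IsReducedCurve f) : contactExponent f = ⊤ ∨
      ∃ q : ℚ, 1 ≤ q ∧ contactExponent f = ENNReal.ofReal (q : ℝ) := by
  obtain ⟨w, p, hw, hp, h⟩ := hf.exists_contactExponent_eq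
  obtain ⟨n, hn0, hn⟩ := hp.1.1.exists_mult_eq
  have hle := mult_le_intersectionNumber hp.1.1.1 hw
  rw [h, branchContact_eq_div hw hn]
  rcases eq_or_ne (intersectionNumber p w) ⊤ with h1 | h1
  · left
    rw [h1, ENat.toENNReal_top, ENNReal.top_div_of_ne_top (ENNReal.natCast_ne_top n)]
  · right
    obtain ⟨a, ha⟩ := ENat.ne_top_iff_exists.1 h1
    rw [← ha, hn, Nat.cast_le] at hle
    refine ⟨(a : ℚ) / n, ?_, ?_⟩
    · rw [one_le_div (by exact_mod_cast Nat.pos_of_ne_zero hn0)]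
      exact_mod_cast hle
    · rw [← ha, ENat.toENNReal_coe]
      push_cast
      rw [ENNReal.ofReal_div_of_pos (by exact_mod_cast Nat.pos_of_ne_zero hn0),
        ENNReal.ofReal_natCast, ENNReal.ofReal_natCast]

theorem one_le_contact [Infinite K] {f w : MvPowerSeries (Fin 2) K} (hw : IsSmoothBranch w) :
    1 ≤ contact f w := by
  rw [contact_eq_iInf f hw.1]
  refine le_iInf₂ fun p hp => ?_
  obtain ⟨n, hn0, hn⟩ := hp.1.1.exists_mult_eq
  have h1 := natCast_eq_div hn0 1
  rw [Nat.cast_one, mul_one] at h1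
  rw [branchContact_eq_div hw hn, h1]
  apply (strictMono_natCast_div hn0).monotone
  rw [← hn]
  exact mult_le_intersectionNumber hp.1.1.1 hw

theorem one_lt_contact_iff [Infinite K] {f w : MvPowerSeries (Fin 2) K} (hf : IsCurve f)
    (hw : IsSmoothBranch w) {v : Fin 2 → K} (hv : v ≠ 0)
    (hwv : MvPolynomial.eval v (initialForm w) = 0) :
    1 < contact f w ↔ ∀ p, IsComponent p f → MvPolynomial.eval v (initialForm p) = 0 := by
  have key : ∀ p, IsComponent p f →
      (1 < branchContact p w ↔ MvPolynomial.eval v (initialForm p) = 0) := by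
    intro p hp
    obtain ⟨n, hn0, hn⟩ := hp.1.1.exists_mult_eq
    have h1 := natCast_eq_div hn0 1
    rw [Nat.cast_one, mul_one] at h1
    obtain ⟨h2, h3⟩ := intersectionNumber_smooth hp.1.1.1 hw hv hwv
    rw [branchContact_eq_div hw hn, h1, (strictMono_natCast_div hn0).lt_iff_lt, ← hn,
      lt_iff_le_and_ne, and_iff_right h2, ← not_iff_not, not_not, eq_comm]
    exact h3
  constructor
  · intro h p hp
    exact (key p hp).1 (h.trans_le (contact_le_branchContact hp hw))
  · intro h
    obtain ⟨p, hp, h'⟩ := hf.exists_contact_eq hw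
    rw [h']
    exact (key p hp).2 (h p hp)

/-- Contact 1 is integral, hence can be improved; a smooth branch with contact above 1 shares its
tangent with `p`. -/
theorem IsBranch.exists_tangent [IsAlgClosed K] {p : MvPowerSeries (Fin 2) K}
    (hp : IsBranch p) : ∃ v : Fin 2 → K, v ≠ 0 ∧ MvPolynomial.eval v (initialForm p) = 0 := by
  obtain ⟨n, hn0, hn⟩ := hp.1.exists_mult_eq
  obtain ⟨w₀, hw₀⟩ := exists_isSmoothBranch (K := K)
  have h0 := mult_le_intersectionNumber hp.1.1 hw₀
  obtain ⟨w, hw, hlt⟩ : ∃ w, IsSmoothBranch w ∧ mult p < intersectionNumber p w := by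
    rcases h0.eq_or_lt with h | h
    · obtain ⟨w, hw, h1⟩ := hp.exists_intersectionNumber_lt hw₀ hn (N := 1)
        (by rw [← h, hn, mul_one])
      exact ⟨w, hw, h ▸ h1⟩
    · exact ⟨w₀, hw₀, h⟩
  obtain ⟨ψ, hψw, hψ, ht⟩ := hw.exists_parametrization
  refine ⟨_, ht, ?_⟩
  by_contra h
  exact hlt.ne' ((intersectionNumber_smooth hp.1.1 hw ht
    (hψw.eval_initialForm_eq_zero hψ hw.1.1.1)).2.2 h)

theorem IsReducedCurve.contactExponent_eq_one_iff [IsAlgClosed K]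
    {f : MvPowerSeries (Fin 2) K} (hf : IsReducedCurve f) :
    contactExponent f = 1 ↔ 2 ≤ (tangentCone f).encard := by
  have hone : (2 : ℕ∞) = 1 + 1 := by norm_num
  rw [hone, ENat.add_one_le_iff ENat.one_ne_top, Set.one_lt_encard_iff]
  have htan : ∀ p, IsComponent p f → ∀ v : Fin 2 → K, MvPolynomial.eval v (initialForm p) = 0 →
      v ≠ 0 → MvPolynomial.eval v (initialForm f) = 0 := by
    intro p hp v hpv hv
    by_contra h
    exact hp.eval_initialForm_ne_zero hf.1.1 hv h hpv
  constructor
  · intro h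
    -- With only one tangent, all components share it, and a smooth branch in that direction has
    -- contact above 1.
    by_contra! hcone
    obtain ⟨p₀, hp₀⟩ := hf.1.exists_isComponent
    obtain ⟨v, hv, hpv⟩ := hp₀.1.exists_tangent
    obtain ⟨w, hw, hwv⟩ := exists_isSmoothBranch_tangent hv
    have hlt : 1 < contact f w := by
      rw [one_lt_contact_iff hf.1 hw hv hwv]
      intro p hp
      obtain ⟨u, hu, hpu⟩ := hp.1.exists_tangent
      have h1 := hcone (Projectivization.mk K v hv) (Projectivization.mk K u hu)
        ((mk_mem_tangentCone f v hv).2 (htan p₀ hp₀ v hpv hv))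
        ((mk_mem_tangentCone f u hu).2 (htan p hp u hpu hu))
      obtain ⟨a, rfl⟩ := (Projectivization.mk_eq_mk_iff' K v u hv hu).1 h1
      rw [eval_smul_initialForm, hpu, mul_zero]
    have := hlt.trans_le (contact_le_contactExponent f hw)
    exact this.ne' h
  · rintro ⟨P, Q, hP, hQ, hPQ⟩
    obtain ⟨w₀, hw₀⟩ := exists_isSmoothBranch (K := K)
    refine le_antisymm (iSup₂_le fun w hw => ?_)
      ((one_le_contact hw₀).trans (contact_le_contactExponent f hw₀))
    by_contra! hlt
    obtain ⟨ψ, hψw, hψ, ht⟩ := hw.exists_parametrization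
    have hall := (one_lt_contact_iff hf.1 hw ht
      (hψw.eval_initialForm_eq_zero hψ hw.1.1.1)).1 hlt
    -- Each tangent of `f` belongs to some component, and that component's only tangent is the one
    -- of `w`.
    have key : ∀ P ∈ tangentCone f, P = Projectivization.mk K (tangentVector ψ) ht := by
      intro P hP
      obtain ⟨p, hp, hpv⟩ := exists_isComponent_eval_eq_zero hf.1.1 P.rep_nonzero hP
      obtain ⟨t, ht'⟩ := hp.1.tangent_unique ht P.rep_nonzero (hall p hp) hpv
      rw [← P.mk_rep]
      exact (Projectivization.mk_eq_mk_iff' K _ _ _ _).2 ⟨t, ht'.symm⟩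
    exact hPQ ((key P hP).trans (key Q hQ).symm)

theorem IsBranch.contactExponent_ne_natCast [IsAlgClosed K]
    {p : MvPowerSeries (Fin 2) K} (hp : IsBranch p) (N : ℕ) : contactExponent p ≠ N := by
  intro h
  obtain ⟨w, hw, hmax⟩ := hp.isReducedCurve.exists_hasMaximalContact
  obtain ⟨n, hn0, hn⟩ := hp.1.exists_mult_eq
  rw [h, contact_eq_branchContact hp hw.1, branchContact_eq_div hw hn, natCast_eq_div hn0 N] at hmax
  have hi := (strictMono_natCast_div hn0).injective hmax
  obtain ⟨w', hw', hlt⟩ := hp.exists_intersectionNumber_lt hw hn hi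
  rw [hi] at hlt
  have h1 := contact_le_contactExponent p hw'
  rw [h, contact_eq_branchContact hp hw'.1, branchContact_eq_div hw' hn,
    natCast_eq_div hn0 N] at h1
  exact (strictMono_natCast_div hn0 hlt).not_ge h1

/-- Let `w` have maximal contact with `f`, attained at the component `p`. A strict inequality means
that `w` is not maximal for `p`, so the contact is integral. Conversely, the infimum is attained at
some component, whose exponent is at least that of `f` and is never an integer. -/
theorem IsReducedCurve.contactExponent_lt_iInf_iff [IsAlgClosed K]
    {f : MvPowerSeries (Fin 2) K} (hf : IsReducedCurve f) :
    contactExponent f < (⨅ (p : MvPowerSeries (Fin 2) K) (_ : IsComponent p f),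
      contactExponent p) ↔ ∃ n : ℕ, contactExponent f = (n : ℝ≥0∞) := by
  constructor
  · intro hlt
    obtain ⟨w, p, hw, hp, h⟩ := hf.exists_contactExponent_eq
    obtain ⟨n, hn0, hn⟩ := hp.1.1.exists_mult_eq
    have hltp := hlt.trans_le
      (iInf₂_le (f := fun p (_ : IsComponent p f) => contactExponent p) p hp)
    have hfin : intersectionNumber p w ≠ ⊤ := by
      intro h1
      rw [h, branchContact_eq_div hw hn, h1, ENat.toENNReal_top,
        ENNReal.top_div_of_ne_top (ENNReal.natCast_ne_top n)] at hltp
      exact not_top_lt hltp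
    obtain ⟨a, ha⟩ := ENat.ne_top_iff_exists.1 hfin
    by_cases hdvd : n ∣ a
    · obtain ⟨N, rfl⟩ := hdvd
      exact ⟨N, by rw [h, branchContact_eq_div hw hn, natCast_eq_div hn0 N, ha]⟩
    · exfalso
      refine hltp.not_ge (iSup₂_le fun w' hw' => ?_)
      rw [h, contact_eq_branchContact hp.1 hw'.1, branchContact_eq_div hw' hn,
        branchContact_eq_div hw hn]
      exact (strictMono_natCast_div hn0).monotone
        (hp.1.intersectionNumber_le_of_not_dvd hw hw' hn ha.symm hdvd)
  · rintro ⟨N, hN⟩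
    obtain ⟨p₀, hp₀⟩ := hf.1.exists_isComponent
    have : Nonempty {p // IsComponent p f} := ⟨⟨p₀, hp₀⟩⟩
    obtain ⟨M, -, hM⟩ := exists_branchContact_eq_div hf.1
    obtain ⟨⟨p, hp⟩, hmin⟩ := exists_min_of_denominator (M := M)
      (fun p : {p // IsComponent p f} => contactExponent p.1) (fun p => by
        obtain ⟨w, hw, hmax⟩ := p.2.1.isReducedCurve.exists_hasMaximalContact
        rw [← hmax, contact_eq_branchContact p.2.1 hw.1]
        exact hM p.1 w p.2 hw)
    refine lt_of_lt_of_le (lt_of_le_of_ne (contactExponent_le_of_isComponent hp) ?_)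
      (le_iInf₂ fun q hq => hmin ⟨q, hq⟩)
    rw [hN]
    exact (hp.1.contactExponent_ne_natCast N).symm

end PlaneCurve

end

theorem mainTheorem12 {K : Type*} [Field K] [IsAlgClosed K]
    (f : MvPowerSeries (Fin 2) K) (hf : PlaneCurve.IsReducedCurve f) :
    (PlaneCurve.contactExponent f = ⊤ ∨
      ∃ q : ℚ, 1 ≤ q ∧ PlaneCurve.contactExponent f = ENNReal.ofReal (q : ℝ)) ∧
    (∃ w : MvPowerSeries (Fin 2) K, PlaneCurve.HasMaximalContact w f) ∧
    (PlaneCurve.contactExponent f = ⊤ ↔ PlaneCurve.IsSmoothBranch f) ∧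
    (PlaneCurve.contactExponent f = 1 ↔ 2 ≤ (PlaneCurve.tangentCone f).encard) ∧
    (PlaneCurve.contactExponent f <
        (⨅ (p : MvPowerSeries (Fin 2) K) (_ : PlaneCurve.IsComponent p f),
          PlaneCurve.contactExponent p) ↔
      ∃ n : ℕ, PlaneCurve.contactExponent f = (n : ENNReal)) := by
  exact ⟨hf.contactExponent_rational, hf.exists_hasMaximalContact, hf.contactExponent_eq_top_iff,
    hf.contactExponent_eq_one_iff, hf.contactExponent_lt_iInf_iff⟩
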